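/- Let $0\le q<p\le 1$. There are constants $C_2=C_2(p,q)>0$ and $C_3=C_3(p,q)>0$ with the following property. Let $1\le s<l$ be integers, and let $n=2l+s$ nodes be partitioned into communities $\alpha,\beta,\gamma$ of sizes $l,l,s$. Let $W_A,W_B\in\{0,1\}^{n\times n}$ be random symmetric matrices on a common probability space, each following a stochastic block model: the entries $W_{ij}$, $i\le j$, of each matrix are independent, with $\Pr(W_{ij}=1)=p$ if $i,j$ belong to the same community (in particular if $i=j$) and $\Pr(W_{ij}=1)=q$ otherwise, where the communities of $W_A$ are $\alpha$ and $\beta\cup\gamma$, and those of $W_B$ are $\alpha,\beta,\gamma$. No assumption is made on the joint distribution of $W_A$ and $W_B$. All eigenvectors are orthonormal and are ordered by non-increasing eigenvalue. Let $v_\gamma$ be the third eigenvector of $\mathbb E[W_B]$, let $u_\alpha,u_\beta$ be two leading eigenvectors of $W_A$, let $Q_{W_A}=I-u_\alpha u_\alpha^T-u_\beta u_\beta^T$, and let $\tilde v_\gamma$ be a leading unit eigenvector of $Q_{W_A}W_BQ_{W_A}$. Then, with probability at least $1-\exp(-l)$, for all choices of these eigenvectors, up to the sign of $\tilde v_\gamma$,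 \[ \min\bigl(\|\tilde v_\gamma-v_\gamma\|,\ \|\tilde v_\gamma+v_\gamma\|\bigr)\ \le\ C_2(p,q)\frac{\sqrt l}{s}+C_3(p,q)\sqrt{\frac sl}, \] where $\|\cdot\|$ is the Euclidean norm. -/

import Mathlib

open MeasureTheory ProbabilityTheory

/-- `W` is the symmetric random weight matrix of a stochastic block model on `n` nodes with
community labels `c`: the entries on and above the diagonal are independent Bernoulli variables,
with success probability `p` inside a community (the diagonal included) and `q` between two
different communities. -/
structure IsSBM {Ω : Type*} [MeasurableSpace Ω] (μ : Measure Ω) {n : ℕ} {κ : Type*}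
    [DecidableEq κ] (c : Fin n → κ) (p q : ℝ) (W : Ω → Matrix (Fin n) (Fin n) ℝ) : Prop where
  measurable : ∀ i j, Measurable fun ω => W ω i j
  symm : ∀ ω, (W ω).IsSymm
  zero_or_one : ∀ ω i j, W ω i j = 0 ∨ W ω i j = 1
  prob_one : ∀ i j, μ.real {ω | W ω i j = 1} = if c i = c j then p else q
  indep : iIndepFun
    (fun (e : {e : Fin n × Fin n // e.1 ≤ e.2}) (ω : Ω) => W ω e.1.1 e.1.2) μ

/-- The entrywise expectation of a random matrix. -/
noncomputable def expMatrix {Ω : Type*} [MeasurableSpace Ω] (μ : Measure Ω) {n : ℕ}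
    (W : Ω → Matrix (Fin n) (Fin n) ℝ) : Matrix (Fin n) (Fin n) ℝ :=
  Matrix.of fun i j => ∫ ω, W ω i j ∂μ

/-- `u 0, …, u (k - 1)` are `k` leading eigenvectors of `M`: the first `k` vectors of an
orthonormal eigenbasis of `M` that is listed by non-increasing eigenvalues. -/
def IsLeadingEigenvectors {n k : ℕ} (M : Matrix (Fin n) (Fin n) ℝ)
    (u : Fin k → EuclideanSpace ℝ (Fin n)) : Prop :=
  ∃ (b : OrthonormalBasis (Fin n) ℝ (EuclideanSpace ℝ (Fin n))) (ev : Fin n → ℝ),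
    Antitone ev ∧ (∀ i, Matrix.toEuclideanLin M (b i) = ev i • b i) ∧
      ∃ h : k ≤ n, ∀ i : Fin k, u i = b (Fin.castLE h i)

/-- The matrix `I - u₀ u₀ᵀ - u₁ u₁ᵀ`. -/
noncomputable def projOff {n : ℕ} (u : Fin 2 → EuclideanSpace ℝ (Fin n)) :
    Matrix (Fin n) (Fin n) ℝ :=
  1 - Matrix.vecMulVec (u 0).ofLp (u 0).ofLp - Matrix.vecMulVec (u 1).ofLp (u 1).ofLp

/-- The labels `0, 1, 2` stand for the communities `α, β, γ` of graph `B`.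
In graph `A` the communities are `α` and `β ∪ γ`. -/
def mergeBetaGamma : Fin 3 → Fin 2 := ![0, 1, 1]

/-!
The proof separates a concentration bound from a deterministic perturbation argument.

**Concentration.** The centred weight matrix has operator norm at most `16 √l` with probability at
least `1 - exp (-l) / 2`: its bilinear form at two fixed vectors of the unit ball is sub-Gaussian by
Hoeffding's lemma (`IsSBM.measure_inner_ge_le`), and a union bound over pairs of points of a
`1/2`-net gives `IsSBM.exists_concentration_event`. A further union bound covers `W_A` and `W_B`.

**Perturbation.** Write `d = p - q`, let `e₀, e₁, e₂` be the indicator vectors of `α, β, γ`, and put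
`r = l e₂ - s e₁` (`splitVec`), which spans the orthogonal complement of `e₀` and `e₁ + e₂` inside
the span of the three. The mean of `W_A` has rank two with a spectral gap of order `l`, so the
projection `Q` off its two leading eigenvectors maps `e₀` and `e₁ + e₂` to vectors of bounded norm
(`norm_offProj_community_le`) and moves `r` by a relative amount `O(1 / √l)`
(`norm_sub_offProj_le`). Hence the compression of the mean of `W_B` by `Q` is `θ z zᵀ` up to an
error `O(√l)`, where `z = r / ‖r‖` and `θ = 2 d l s / (l + s) ≥ d s`
(`norm_compression_mean_sub_le`), and the leading eigenvector of `Q W_B Q` is within `O(√l / s)` of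
`± z` (`signDist_leading_eigenvector_le`).

Finally both `z` and the third eigenvector of the mean of `W_B` are within `O(√(s / l))` of
`± e₂ / √s` (`signDist_normalized_splitVec_le`, `signDist_third_eigenvector_le`).
-/

open scoped RealInnerProductSpace

/-! ### Extremal characterisation of eigenvalues -/

section Spectral

variable {E : Type*} [NormedAddCommGroup E] [InnerProductSpace ℝ E]

lemma inner_eigenbasis_apply {ι : Type*} [Fintype ι] (b : OrthonormalBasis ι ℝ E) {ev : ι → ℝ}
    {T : E →ₗ[ℝ] E} (hT : ∀ i, T (b i) = ev i • b i) (i : ι) (x : E) :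
    ⟪b i, T x⟫ = ev i * ⟪b i, x⟫ := by
  classical
  conv_lhs => rw [← b.sum_repr x]
  simp only [map_sum, map_smul, hT, inner_sum, inner_smul_right, b.inner_eq_ite,
    b.repr_apply_apply]
  simp [mul_comm]

lemma inner_apply_self_eq_sum_eigenvalues {ι : Type*} [Fintype ι] (b : OrthonormalBasis ι ℝ E)
    {ev : ι → ℝ} {T : E →ₗ[ℝ] E} (hT : ∀ i, T (b i) = ev i • b i) (x : E) :
    ⟪T x, x⟫ = ∑ i, ev i * ⟪b i, x⟫ ^ 2 := by
  rw [← b.sum_inner_mul_inner]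
  refine Finset.sum_congr rfl fun i _ => ?_
  rw [real_inner_comm, inner_eigenbasis_apply b hT]
  ring

lemma norm_apply_sq_eq_sum_eigenvalues {ι : Type*} [Fintype ι] (b : OrthonormalBasis ι ℝ E)
    {ev : ι → ℝ} {T : E →ₗ[ℝ] E} (hT : ∀ i, T (b i) = ev i • b i) (x : E) :
    ‖T x‖ ^ 2 = ∑ i, ev i ^ 2 * ⟪b i, x⟫ ^ 2 := by
  rw [← b.sum_sq_inner_right]
  refine Finset.sum_congr rfl fun i _ => ?_
  rw [inner_eigenbasis_apply b hT]
  ring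

/-- Among `k + 1` vectors some nontrivial combination satisfies `k` orthogonality conditions. -/
lemma exists_combination_orthogonal {k : ℕ} (y : Fin (k + 1) → E) (x : Fin k → E) :
    ∃ c : Fin (k + 1) → ℝ, c ≠ 0 ∧ ∀ j, ⟪x j, ∑ i, c i • y i⟫ = 0 := by
  let f : (Fin (k + 1) → ℝ) →ₗ[ℝ] (Fin k → ℝ) :=
    LinearMap.pi fun j => (innerₛₗ ℝ (x j)).comp (Fintype.linearCombination ℝ y)
  have hf : LinearMap.ker f ≠ ⊥ := LinearMap.ker_ne_bot_of_finrank_lt (by simp)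
  obtain ⟨c, hc, hc0⟩ := Submodule.exists_mem_ne_zero_of_ne_bot hf
  refine ⟨c, hc0, fun j => ?_⟩
  have := congrFun (LinearMap.mem_ker.1 hc) j
  simpa [f, Fintype.linearCombination_apply] using this

variable {n : ℕ} {b : OrthonormalBasis (Fin n) ℝ E} {ev : Fin n → ℝ} {T : E →ₗ[ℝ] E}

/-- The eigenvalue of index `k` is at most the maximum of the Rayleigh quotient on the orthogonal
complement of any `k` vectors. -/
lemma eigenvalue_le_of_forall_orthogonal (hev : Antitone ev) (hT : ∀ i, T (b i) = ev i • b i)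
    {k : ℕ} (hk : k < n) (x : Fin k → E) {m : ℝ}
    (h : ∀ t, (∀ j, ⟪x j, t⟫ = 0) → ⟪T t, t⟫ ≤ m * ‖t‖ ^ 2) : ev ⟨k, hk⟩ ≤ m := by
  obtain ⟨c, hc0, hc⟩ := exists_combination_orthogonal
    (fun i : Fin (k + 1) => b (Fin.castLE hk i)) x
  set t := ∑ i, c i • b (Fin.castLE hk i) with ht
  have hon : Orthonormal ℝ fun i : Fin (k + 1) => b (Fin.castLE hk i) :=
    b.orthonormal.comp _ (Fin.castLE_injective hk)
  have hnorm : ‖t‖ ^ 2 = ∑ i, c i ^ 2 := by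
    rw [← real_inner_self_eq_norm_sq, ht, hon.inner_sum]
    simp [sq]
  have hTt : T t = ∑ i, (c i * ev (Fin.castLE hk i)) • b (Fin.castLE hk i) := by
    simp [ht, hT, smul_smul]
  have hpos : 0 < ‖t‖ ^ 2 := by
    obtain ⟨i, hi⟩ := Function.ne_iff.1 hc0
    rw [hnorm]
    exact Finset.sum_pos' (fun _ _ => sq_nonneg _) ⟨i, Finset.mem_univ _, by
      have : c i ≠ 0 := hi
      positivity⟩
  have hge : ev ⟨k, hk⟩ * ‖t‖ ^ 2 ≤ ⟪T t, t⟫ := by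
    rw [hTt, ht, hon.inner_sum, ← ht, hnorm, Finset.mul_sum]
    refine Finset.sum_le_sum fun i _ => ?_
    have : ev ⟨k, hk⟩ ≤ ev (Fin.castLE hk i) := hev (by
      rw [Fin.le_def]; exact Nat.lt_succ_iff.1 i.2)
    simp only [conj_trivial]
    nlinarith [sq_nonneg (c i)]
  exact le_of_mul_le_mul_right (hge.trans (h t hc)) hpos

/-- The eigenvalue of index `k` is at least the minimum of the Rayleigh quotient on the span of any
`k + 1` linearly independent vectors. -/
lemma le_eigenvalue_of_forall_combination (hev : Antitone ev) (hT : ∀ i, T (b i) = ev i • b i)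
    {k : ℕ} (hk : k < n) (y : Fin (k + 1) → E) (hy : LinearIndependent ℝ y) {m : ℝ}
    (h : ∀ c : Fin (k + 1) → ℝ,
      m * ‖∑ i, c i • y i‖ ^ 2 ≤ ⟪T (∑ i, c i • y i), ∑ i, c i • y i⟫) : m ≤ ev ⟨k, hk⟩ := by
  obtain ⟨c, hc0, hc⟩ := exists_combination_orthogonal y
    (fun i : Fin k => b (Fin.castLE hk.le i))
  have h := h c
  set t := ∑ i, c i • y i with ht
  have ht0 : t ≠ 0 := fun h0 => hc0 (funext (Fintype.linearIndependent_iff.1 hy c h0))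
  have hpos : 0 < ‖t‖ ^ 2 := by positivity
  have hle : ⟪T t, t⟫ ≤ ev ⟨k, hk⟩ * ‖t‖ ^ 2 := by
    rw [inner_apply_self_eq_sum_eigenvalues b hT, ← b.sum_sq_inner_right, Finset.mul_sum]
    refine Finset.sum_le_sum fun i _ => ?_
    rcases lt_or_ge i.1 k with hi | hi
    · have : ⟪b i, t⟫ = 0 := hc ⟨i, hi⟩
      simp [this]
    · have : ev i ≤ ev ⟨k, hk⟩ := hev (by rw [Fin.le_def]; exact hi)
      nlinarith [sq_nonneg ⟪b i, t⟫]
  exact le_of_mul_le_mul_right (h.trans hle) hpos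

end Spectral

/-! ### The operator norm and nets of the unit ball -/

section Net

variable {E : Type*} [NormedAddCommGroup E] [InnerProductSpace ℝ E]

/-- The unit ball of a `d`-dimensional space has a `1/2`-net with at most `5 ^ d` points, namely a
`1/2`-separated set of maximal cardinality. -/
lemma exists_half_net [FiniteDimensional ℝ E] :
    ∃ N : Finset E, N.card ≤ 5 ^ Module.finrank ℝ E ∧
    (∀ x ∈ N, ‖x‖ ≤ 1) ∧ ∀ x : E, ‖x‖ ≤ 1 → ∃ y ∈ N, ‖x - y‖ ≤ 1 / 2 := by
  classical
  let P : Finset E → Prop := fun s =>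
    (∀ x ∈ s, ‖x‖ ≤ 1) ∧ ∀ x ∈ s, ∀ y ∈ s, x ≠ y → 1 / 2 ≤ ‖x - y‖
  have hcard : ∀ s, P s → s.card ≤ 5 ^ Module.finrank ℝ E := by
    intro s hs
    have hinj : Function.Injective fun x : E => (2 : ℝ) • x :=
      smul_right_injective E (two_ne_zero)
    rw [← Finset.card_image_of_injective s hinj]
    refine Besicovitch.card_le_of_separated _ ?_ ?_
    · simp only [Finset.mem_image]
      rintro _ ⟨x, hx, rfl⟩
      rw [norm_smul]
      have := hs.1 x hx
      norm_num
      linarith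
    · simp only [Finset.mem_image]
      rintro _ ⟨x, hx, rfl⟩ _ ⟨y, hy, rfl⟩ hxy
      have := hs.2 x hx y hy (fun h => hxy (by rw [h]))
      rw [← smul_sub, norm_smul]
      norm_num
      linarith
  let S : Set ℕ := {k | ∃ s, P s ∧ s.card = k}
  have hne : S.Nonempty := ⟨0, ∅, ⟨by simp, by simp⟩, rfl⟩
  have hbdd : BddAbove S := ⟨_, by rintro _ ⟨s, hs, rfl⟩; exact hcard s hs⟩
  obtain ⟨N, hN, hNc⟩ := Nat.sSup_mem hne hbdd
  refine ⟨N, hcard N hN, hN.1, fun x hx => ?_⟩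
  by_contra! hcon
  have hxN : x ∉ N := fun h => by
    have := hcon x h
    norm_num at this
  have hP : P (insert x N) := by
    refine ⟨fun y hy => ?_, fun y hy z hz hyz => ?_⟩
    · rcases Finset.mem_insert.1 hy with rfl | hy
      exacts [hx, hN.1 y hy]
    · rcases Finset.mem_insert.1 hy with hy' | hy' <;> rcases Finset.mem_insert.1 hz with hz' | hz'
      · exact absurd (hy'.trans hz'.symm) hyz
      · rw [hy']; exact (hcon z hz').le
      · rw [hz', norm_sub_rev]; exact (hcon y hy').le
      · exact hN.2 y hy' z hz' hyz
  have := le_csSup hbdd ⟨insert x N, hP, rfl⟩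
  rw [Finset.card_insert_of_notMem hxN, hNc] at this
  omega

/-- A linear map is controlled by its bilinear form on a `1/2`-net: passing from the ball to the
net costs a factor `2` in each of the two arguments. -/
lemma norm_apply_le_of_net {N : Finset E} (hN : ∀ x : E, ‖x‖ ≤ 1 → ∃ y ∈ N, ‖x - y‖ ≤ 1 / 2)
    {m : ℝ} (hm : 0 ≤ m) (T : E →L[ℝ] E) (h : ∀ x ∈ N, ∀ y ∈ N, ⟪T x, y⟫ ≤ m) (x : E) :
    ‖T x‖ ≤ 4 * m * ‖x‖ := by
  have hnet : ∀ x ∈ N, ‖T x‖ ≤ 2 * m := by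
    intro x hx
    rcases eq_or_ne (T x) 0 with h0 | h0
    · rw [h0, norm_zero]; linarith
    have hpos : 0 < ‖T x‖ := norm_pos_iff.2 h0
    obtain ⟨y, hy, hyd⟩ := hN (‖T x‖⁻¹ • T x) (by
      rw [norm_smul, norm_inv, norm_norm, inv_mul_cancel₀ hpos.ne'])
    have h1 : ⟪T x, ‖T x‖⁻¹ • T x⟫ = ‖T x‖ := by
      rw [inner_smul_right, real_inner_self_eq_norm_sq]
      field_simp
    have h2 : ⟪T x, ‖T x‖⁻¹ • T x - y⟫ ≤ ‖T x‖ * (1 / 2) :=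
      (real_inner_le_norm _ _).trans (by gcongr)
    rw [inner_sub_right, h1] at h2
    linarith [h x hx y hy]
  have hop : ‖T‖ ≤ 2 * m + ‖T‖ / 2 := by
    refine ContinuousLinearMap.opNorm_le_of_unit_norm (by positivity) fun x hx => ?_
    obtain ⟨y, hy, hyd⟩ := hN x hx.le
    calc ‖T x‖ = ‖T y + T (x - y)‖ := by rw [map_sub]; congr 1; abel
      _ ≤ ‖T y‖ + ‖T (x - y)‖ := norm_add_le _ _
      _ ≤ 2 * m + ‖T‖ * (1 / 2) := by
        gcongr
        · exact hnet y hy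
        · exact (T.le_opNorm _).trans (by gcongr)
      _ = _ := by ring
  exact (T.le_opNorm x).trans (by gcongr; linarith)

end Net

/-! ### Concentration of the weight matrix around its mean -/

section Concentration

open scoped NNReal

variable {Ω : Type*} [MeasurableSpace Ω] {μ : Measure Ω}

lemma ProbabilityTheory.HasSubgaussianMGF.mono {X : Ω → ℝ} {c d : ℝ≥0}
    (h : HasSubgaussianMGF X c μ) (hcd : c ≤ d) : HasSubgaussianMGF X d μ where
  integrable_exp_mul := h.integrable_exp_mul
  mgf_le t := (h.mgf_le t).trans (by gcongr)

/-- A double sum folded onto the pairs `i ≤ j`. -/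
lemma sum_sum_eq_sum_upper {n : ℕ} (f : Fin n → Fin n → ℝ) :
    ∑ i, ∑ j, f i j = ∑ e : {e : Fin n × Fin n // e.1 ≤ e.2},
      if e.1.1 = e.1.2 then f e.1.1 e.1.2 else f e.1.1 e.1.2 + f e.1.2 e.1.1 := by
  have h1 : ∀ i j, f i j = (if i ≤ j then f i j else 0) + (if j < i then f i j else 0) := by
    intro i j
    rcases le_or_gt i j with h | h
    · simp [h, h.not_gt]
    · simp [h, h.not_ge]
  have h2 : ∑ i, ∑ j, (if j < i then f i j else 0) = ∑ i, ∑ j, if i < j then f j i else 0 :=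
    Finset.sum_comm
  rw [Finset.sum_congr rfl fun i _ => Finset.sum_congr rfl fun j _ => h1 i j]
  simp only [Finset.sum_add_distrib]
  rw [h2]
  simp only [← Finset.sum_add_distrib]
  rw [← Finset.sum_product', Finset.univ_product_univ,
    ← Finset.sum_subtype (Finset.univ.filter fun e : Fin n × Fin n => e.1 ≤ e.2) (by simp)
      (fun e => if e.1 = e.2 then f e.1 e.2 else f e.1 e.2 + f e.2 e.1), Finset.sum_filter]
  refine Finset.sum_congr rfl fun e _ => ?_
  rcases lt_trichotomy e.1 e.2 with h | h | h
  · simp [h, h.le, h.ne]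
  · simp [h]
  · simp [h.not_ge, h.not_gt]

variable {n : ℕ} {κ : Type*} [DecidableEq κ] {c : Fin n → κ} {p q : ℝ}
  {W : Ω → Matrix (Fin n) (Fin n) ℝ}

lemma IsSBM.expMatrix_apply (h : IsSBM μ c p q W) (i j : Fin n) :
    expMatrix μ W i j = if c i = c j then p else q := by
  have hset : MeasurableSet {ω | W ω i j = 1} := h.measurable i j (measurableSet_singleton 1)
  rw [← h.prob_one, ← integral_indicator_one hset]
  refine integral_congr_ae (ae_of_all _ fun ω => ?_)
  rcases h.zero_or_one ω i j with h0 | h0 <;> simp [Set.indicator, h0]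

/-- Hoeffding's inequality for the bilinear form of the centred weight matrix. Each unordered pair
of nodes contributes at most `2 (xᵢ² yⱼ² + xⱼ² yᵢ²) / 4` to the variance proxy, which is therefore
at most `1 / 2`. -/
lemma IsSBM.measure_inner_ge_le [IsProbabilityMeasure μ] (h : IsSBM μ c p q W)
    {x y : EuclideanSpace ℝ (Fin n)} (hx : ‖x‖ ≤ 1) (hy : ‖y‖ ≤ 1) {t : ℝ} (ht : 0 ≤ t) :
    μ.real {ω | t ≤ ⟪Matrix.toEuclideanLin (W ω - expMatrix μ W) x, y⟫} ≤
      Real.exp (-t ^ 2) := by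
  let a : {e : Fin n × Fin n // e.1 ≤ e.2} → ℝ := fun e =>
    if e.1.1 = e.1.2 then x e.1.1 * y e.1.2 else x e.1.1 * y e.1.2 + x e.1.2 * y e.1.1
  let X : {e : Fin n × Fin n // e.1 ≤ e.2} → Ω → ℝ := fun e ω =>
    a e * (W ω e.1.1 e.1.2 - ∫ ω', W ω' e.1.1 e.1.2 ∂μ)
  have hX : iIndepFun X μ :=
    h.indep.comp (fun e r => a e * (r - ∫ ω', W ω' e.1.1 e.1.2 ∂μ)) fun e => by fun_prop
  have hsub : ∀ e, HasSubgaussianMGF (X e)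
      (⟨a e ^ 2, sq_nonneg _⟩ * (‖(1 : ℝ) - 0‖₊ / 2) ^ 2) μ := fun e =>
    (hasSubgaussianMGF_of_mem_Icc (h.measurable e.1.1 e.1.2).aemeasurable
      (ae_of_all _ fun ω => by
        rcases h.zero_or_one ω e.1.1 e.1.2 with h0 | h0 <;> simp [h0])).const_mul (a e)
  have hsum : ∀ ω, ⟪Matrix.toEuclideanLin (W ω - expMatrix μ W) x, y⟫ = ∑ e, X e ω := by
    intro ω
    have h1 : ⟪Matrix.toEuclideanLin (W ω - expMatrix μ W) x, y⟫ =
        ∑ i, ∑ j, (W ω i j - expMatrix μ W i j) * (x j * y i) := by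
      simp only [PiLp.inner_apply, Matrix.toLpLin_apply, Matrix.mulVec, dotProduct,
        Matrix.sub_apply, RCLike.inner_apply, conj_trivial, Finset.mul_sum]
      refine Finset.sum_congr rfl fun i _ => Finset.sum_congr rfl fun j _ => ?_
      ring
    rw [h1, sum_sum_eq_sum_upper]
    refine Finset.sum_congr rfl fun e _ => ?_
    have hW : W ω e.1.2 e.1.1 = W ω e.1.1 e.1.2 := (h.symm ω).apply _ _
    have hE : expMatrix μ W e.1.2 e.1.1 = expMatrix μ W e.1.1 e.1.2 := by
      simp only [expMatrix, Matrix.of_apply]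
      exact integral_congr_ae (ae_of_all _ fun ω => (h.symm ω).apply _ _)
    have hE' : expMatrix μ W e.1.1 e.1.2 = ∫ ω', W ω' e.1.1 e.1.2 ∂μ := rfl
    simp only [X, a, hW, hE, hE']
    split_ifs with he
    · rw [he]; ring
    · ring
  have hvar : ∑ e, (⟨a e ^ 2, sq_nonneg _⟩ * (‖(1 : ℝ) - 0‖₊ / 2) ^ 2 : ℝ≥0) ≤ 1 / 2 := by
    rw [← NNReal.coe_le_coe]
    push_cast
    have hxs : ∑ i, x i ^ 2 ≤ 1 := by
      rw [← EuclideanSpace.real_norm_sq_eq]; nlinarith [norm_nonneg x]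
    have hys : ∑ i, y i ^ 2 ≤ 1 := by
      rw [← EuclideanSpace.real_norm_sq_eq]; nlinarith [norm_nonneg y]
    have h2 : ∑ e, a e ^ 2 ≤ 2 * ∑ i, ∑ j, x i ^ 2 * y j ^ 2 := by
      rw [sum_sum_eq_sum_upper, Finset.mul_sum]
      refine Finset.sum_le_sum fun e _ => ?_
      simp only [a]
      split_ifs with he
      · nlinarith [sq_nonneg (x e.1.1 * y e.1.2)]
      · nlinarith [sq_nonneg (x e.1.1 * y e.1.2 - x e.1.2 * y e.1.1)]
    have h3 : ∑ i, ∑ j, x i ^ 2 * y j ^ 2 ≤ 1 := by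
      rw [← Finset.sum_mul_sum]
      exact mul_le_one₀ hxs (Finset.sum_nonneg fun _ _ => sq_nonneg _) hys
    have h4 : ∑ e, a e ^ 2 * (‖(1 : ℝ) - 0‖ / 2) ^ 2 = (∑ e, a e ^ 2) / 4 := by
      rw [Finset.sum_div]
      refine Finset.sum_congr rfl fun e _ => ?_
      norm_num
      ring
    change ∑ e, a e ^ 2 * (‖(1 : ℝ) - 0‖ / 2) ^ 2 ≤ 1 / 2
    rw [h4]
    linarith
  have := ((HasSubgaussianMGF.sum_of_iIndepFun hX (s := Finset.univ)
    fun e _ => hsub e).mono hvar).measure_ge_le ht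
  simp only [hsum]
  refine this.trans (le_of_eq ?_)
  norm_num

/-- With probability at least `1 - exp (-l) / 2`, the weight matrix of a stochastic block model on
`n ≤ 3 l` nodes is within `16 √l` of its mean in operator norm. -/
lemma IsSBM.exists_concentration_event [IsProbabilityMeasure μ] (h : IsSBM μ c p q W) {l : ℕ}
    (hl : 1 ≤ l) (hn : n ≤ 3 * l) :
    ∃ S : Set Ω, MeasurableSet S ∧ μ.real Sᶜ ≤ Real.exp (-(l : ℝ)) / 2 ∧ ∀ ω ∈ S,
      ∀ x : EuclideanSpace ℝ (Fin n),
        ‖Matrix.toEuclideanLin (W ω) x - Matrix.toEuclideanLin (expMatrix μ W) x‖ ≤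
          16 * √(l : ℝ) * ‖x‖ := by
  obtain ⟨N, hNc, hN1, hN⟩ := exists_half_net (E := EuclideanSpace ℝ (Fin n))
  rw [finrank_euclideanSpace_fin] at hNc
  set t := 4 * √(l : ℝ) with ht
  let F : EuclideanSpace ℝ (Fin n) × EuclideanSpace ℝ (Fin n) → Set Ω := fun z =>
    {ω | t ≤ ⟪Matrix.toEuclideanLin (W ω - expMatrix μ W) z.1, z.2⟫}
  have hmeas : ∀ z, MeasurableSet (F z) := by
    intro z
    refine measurableSet_le measurable_const ?_
    have := h.measurable
    simp only [PiLp.inner_apply, Matrix.toLpLin_apply, Matrix.mulVec, dotProduct,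
      Matrix.sub_apply, RCLike.inner_apply, conj_trivial]
    fun_prop
  refine ⟨(⋃ z ∈ N ×ˢ N, F z)ᶜ, (Finset.measurableSet_biUnion _ fun z _ => hmeas z).compl,
    ?_, fun ω hω x => ?_⟩
  · rw [compl_compl]
    have hl1 : (1 : ℝ) ≤ l := by exact_mod_cast hl
    -- There are at most `25 ^ n ≤ exp (12 l)` pairs of net points, each failing with probability at
    -- most `exp (-16 l)`.
    have h25 : (25 : ℝ) ≤ Real.exp 4 := by
      have h1 : (2.7 : ℝ) ≤ Real.exp 1 := by linarith [Real.exp_one_gt_d9]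
      calc (25 : ℝ) ≤ 2.7 ^ 4 := by norm_num
        _ ≤ Real.exp 1 ^ 4 := by gcongr
        _ = Real.exp 4 := by rw [← Real.exp_nat_mul]; norm_num
    have h2 : (2 : ℝ) ≤ Real.exp 1 := by linarith [Real.exp_one_gt_d9]
    calc μ.real (⋃ z ∈ N ×ˢ N, F z) ≤ ∑ z ∈ N ×ˢ N, μ.real (F z) :=
          measureReal_biUnion_finset_le _ _
      _ ≤ ∑ z ∈ N ×ˢ N, Real.exp (-t ^ 2) := by
          refine Finset.sum_le_sum fun z hz => ?_
          rw [Finset.mem_product] at hz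
          exact h.measure_inner_ge_le (hN1 _ hz.1) (hN1 _ hz.2) (by positivity)
      _ = (N.card * N.card : ℕ) * Real.exp (-t ^ 2) := by
          rw [Finset.sum_const, Finset.card_product, nsmul_eq_mul]
      _ ≤ (25 : ℝ) ^ (3 * l) * Real.exp (-t ^ 2) := by
          gcongr
          calc ((N.card * N.card : ℕ) : ℝ) ≤ (5 ^ n * 5 ^ n : ℕ) := by gcongr
            _ = (25 : ℝ) ^ n := by push_cast; rw [← mul_pow]; norm_num
            _ ≤ (25 : ℝ) ^ (3 * l) := by gcongr; norm_num
      _ ≤ Real.exp 4 ^ (3 * l) * Real.exp (-t ^ 2) := by gcongr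
      _ = Real.exp (-(4 * l)) := by
          rw [← Real.exp_nat_mul, ← Real.exp_add, ht, mul_pow, Real.sq_sqrt (by positivity)]
          congr 1; push_cast; ring
      _ ≤ Real.exp (-(l : ℝ) - 1) := by gcongr; linarith
      _ ≤ Real.exp (-(l : ℝ)) / 2 := by
          rw [Real.exp_sub]; gcongr
  · have hb := norm_apply_le_of_net hN (m := t) (by positivity)
      (LinearMap.toContinuousLinearMap (Matrix.toEuclideanLin (W ω - expMatrix μ W)))
      (fun y hy z hz => by
        by_contra! hcon
        exact hω (Set.mem_biUnion (show (y, z) ∈ N ×ˢ N by simp [hy, hz]) hcon.le)) x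
    rw [LinearMap.coe_toContinuousLinearMap', map_sub, LinearMap.sub_apply] at hb
    exact hb.trans (le_of_eq (by rw [ht]; ring))

end Concentration

/-! ### The mean operator of a block model -/

section Mean

variable {E : Type*} [NormedAddCommGroup E] [InnerProductSpace ℝ E] {κ : Type*} [Fintype κ]

/-- The operator `d ∑ₖ eₖ eₖᵀ + q (∑ₖ eₖ) (∑ₖ eₖ)ᵀ`. When the `eₖ` are the indicator vectors of the
communities and `d = p - q`, this is the mean of the weight matrix of a stochastic block model. -/
noncomputable def blockMean (d q : ℝ) (e : κ → E) : E →ₗ[ℝ] E :=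
  d • ∑ k, (innerₛₗ ℝ (e k)).smulRight (e k) +
    q • (innerₛₗ ℝ (∑ k, e k)).smulRight (∑ k, e k)

variable {d q : ℝ} {e : κ → E}

lemma blockMean_apply (x : E) :
    blockMean d q e x = ∑ k, (d * ⟪e k, x⟫ + q * ⟪∑ j, e j, x⟫) • e k := by
  simp [blockMean, add_smul, Finset.sum_add_distrib, Finset.smul_sum, smul_smul, sum_inner]

lemma inner_blockMean_self (x : E) :
    ⟪blockMean d q e x, x⟫ = d * ∑ k, ⟪e k, x⟫ ^ 2 + q * ⟪∑ k, e k, x⟫ ^ 2 := by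
  rw [blockMean_apply, sum_inner]
  simp only [inner_smul_left, conj_trivial, add_mul, Finset.sum_add_distrib]
  congr 1
  · rw [Finset.mul_sum]
    exact Finset.sum_congr rfl fun _ _ => by ring
  · rw [sum_inner, ← Finset.mul_sum, mul_assoc, sq]

lemma inner_sum_smul_of_orthogonal (he : Pairwise fun i j => ⟪e i, e j⟫ = 0) (c : κ → ℝ) (k : κ) :
    ⟪e k, ∑ j, c j • e j⟫ = c k * ‖e k‖ ^ 2 := by
  classical
  rw [inner_sum, Finset.sum_eq_single k]
  · rw [inner_smul_right, real_inner_self_eq_norm_sq]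
  · intro j _ hj
    rw [inner_smul_right, he hj.symm, mul_zero]
  · simp

lemma norm_sum_smul_sq_of_orthogonal (he : Pairwise fun i j => ⟪e i, e j⟫ = 0) (c : κ → ℝ) :
    ‖∑ j, c j • e j‖ ^ 2 = ∑ j, c j ^ 2 * ‖e j‖ ^ 2 := by
  rw [← real_inner_self_eq_norm_sq, sum_inner]
  refine Finset.sum_congr rfl fun k _ => ?_
  rw [inner_smul_left, inner_sum_smul_of_orthogonal he, conj_trivial]
  ring

/-- On the span of the communities the mean is bounded below by `d` times the smallest community
size. -/
lemma le_inner_blockMean_combination (hd : 0 ≤ d) (hq : 0 ≤ q)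
    (he : Pairwise fun i j => ⟪e i, e j⟫ = 0) {m : ℝ} (hm : ∀ k, m ≤ ‖e k‖ ^ 2) (c : κ → ℝ) :
    d * m * ‖∑ j, c j • e j‖ ^ 2 ≤ ⟪blockMean d q e (∑ j, c j • e j), ∑ j, c j • e j⟫ := by
  rw [inner_blockMean_self, norm_sum_smul_sq_of_orthogonal he]
  simp only [inner_sum_smul_of_orthogonal he]
  have : m * ∑ j, c j ^ 2 * ‖e j‖ ^ 2 ≤ ∑ k, (c k * ‖e k‖ ^ 2) ^ 2 := by
    rw [Finset.mul_sum]
    refine Finset.sum_le_sum fun k _ => ?_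
    have := mul_le_mul_of_nonneg_left (hm k) (by positivity : 0 ≤ c k ^ 2 * ‖e k‖ ^ 2)
    nlinarith
  nlinarith [mul_le_mul_of_nonneg_left this hd,
    mul_nonneg hq (sq_nonneg ⟪∑ k, e k, ∑ j, c j • e j⟫)]

/-- The image under the mean is large as soon as some community component is: the `q`-part only
reinforces the contribution of the `d`-part. -/
lemma le_norm_blockMean_sq (hd : 0 ≤ d) (hq : 0 ≤ q)
    (he : Pairwise fun i j => ⟪e i, e j⟫ = 0) {m : ℝ} (hm0 : 0 ≤ m) (hm : ∀ k, m ≤ ‖e k‖ ^ 2)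
    (x : E) : m * d ^ 2 * ∑ k, ⟪e k, x⟫ ^ 2 ≤ ‖blockMean d q e x‖ ^ 2 := by
  rw [blockMean_apply, norm_sum_smul_sq_of_orthogonal he]
  have hS : ⟪∑ j, e j, x⟫ = ∑ k, ⟪e k, x⟫ := sum_inner _ _ _
  set S := ⟪∑ j, e j, x⟫
  calc m * d ^ 2 * ∑ k, ⟪e k, x⟫ ^ 2
      ≤ m * (d ^ 2 * ∑ k, ⟪e k, x⟫ ^ 2 + 2 * d * q * S * ∑ k, ⟪e k, x⟫ + ∑ _k : κ, (q * S) ^ 2) := by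
        rw [mul_assoc]
        refine mul_le_mul_of_nonneg_left ?_ hm0
        have h1 : 0 ≤ ∑ _k : κ, (q * S) ^ 2 := Finset.sum_nonneg fun _ _ => sq_nonneg _
        have h2 : 0 ≤ 2 * d * q * S * ∑ k, ⟪e k, x⟫ := by
          rw [← hS]
          have : 0 ≤ 2 * (d * q) * S ^ 2 := by positivity
          nlinarith
        linarith
    _ = ∑ k, m * (d * ⟪e k, x⟫ + q * S) ^ 2 := by
        simp only [Finset.mul_sum, ← Finset.sum_add_distrib]
        exact Finset.sum_congr rfl fun _ _ => by ring
    _ ≤ _ := Finset.sum_le_sum fun k _ => by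
        rw [mul_comm]
        exact mul_le_mul_of_nonneg_left (hm k) (sq_nonneg _)

end Mean

/-! ### The leading eigenvectors of a perturbed block model -/

section Perturbation

variable {E : Type*} [NormedAddCommGroup E] [InnerProductSpace ℝ E]

/-- The map `x ↦ x - ⟪u₀, x⟫ u₀ - ⟪u₁, x⟫ u₁`, the orthogonal projection off `u₀` and `u₁` when
these are orthonormal. -/
noncomputable def offProj (u : Fin 2 → E) : E →ₗ[ℝ] E :=
  LinearMap.id - (innerₛₗ ℝ (u 0)).smulRight (u 0) - (innerₛₗ ℝ (u 1)).smulRight (u 1)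

lemma offProj_apply (u : Fin 2 → E) (x : E) :
    offProj u x = x - ⟪u 0, x⟫ • u 0 - ⟪u 1, x⟫ • u 1 := by
  simp [offProj]

lemma inner_offProj_left (u : Fin 2 → E) (x y : E) : ⟪offProj u x, y⟫ = ⟪x, offProj u y⟫ := by
  simp only [offProj_apply, inner_sub_left, inner_sub_right, inner_smul_left, inner_smul_right,
    conj_trivial, real_inner_comm]
  ring

variable {u : Fin 2 → E}

lemma inner_offProj_of_orthonormal (hu : Orthonormal ℝ u) (x : E) (k : Fin 2) :
    ⟪u k, offProj u x⟫ = 0 := by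
  have h01 : ⟪u 0, u 1⟫ = 0 := hu.2 (by decide)
  have h10 : ⟪u 1, u 0⟫ = 0 := hu.2 (by decide)
  rw [offProj_apply]
  fin_cases k <;> simp [inner_sub_right, inner_smul_right, hu.1, h01, h10]

lemma offProj_offProj (hu : Orthonormal ℝ u) (x : E) : offProj u (offProj u x) = offProj u x := by
  rw [offProj_apply u (offProj u x), inner_offProj_of_orthonormal hu,
    inner_offProj_of_orthonormal hu]
  simp

lemma inner_offProj_self (hu : Orthonormal ℝ u) (x : E) :
    ⟪x, offProj u x⟫ = ‖offProj u x‖ ^ 2 := by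
  rw [← real_inner_self_eq_norm_sq, inner_offProj_left, offProj_offProj hu]

lemma norm_offProj_le (hu : Orthonormal ℝ u) (x : E) : ‖offProj u x‖ ≤ ‖x‖ := by
  have h1 := inner_offProj_self hu x
  have h2 := real_inner_le_norm x (offProj u x)
  nlinarith [norm_nonneg x, norm_nonneg (offProj u x)]

lemma norm_sub_offProj_sq (hu : Orthonormal ℝ u) (x : E) :
    ‖x - offProj u x‖ ^ 2 = ⟪u 0, x⟫ ^ 2 + ⟪u 1, x⟫ ^ 2 := by
  have h : x - offProj u x = ∑ k, ⟪u k, x⟫ • u k := by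
    rw [offProj_apply, Fin.sum_univ_two]; abel
  rw [h, ← real_inner_self_eq_norm_sq, hu.inner_sum, Fin.sum_univ_two]
  simp [sq]

variable {n : ℕ} {b : OrthonormalBasis (Fin n) ℝ E} {ev : Fin n → ℝ} {A : E →ₗ[ℝ] E}
  {d q m δ : ℝ} {e : Fin 2 → E}

lemma abs_inner_sub_le {A B : E →ₗ[ℝ] E} (h : ∀ x, ‖A x - B x‖ ≤ δ * ‖x‖) (x : E) :
    |⟪A x, x⟫ - ⟪B x, x⟫| ≤ δ * ‖x‖ ^ 2 := by
  rw [← inner_sub_left, sq, ← mul_assoc]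
  exact (abs_real_inner_le_norm _ _).trans (by gcongr; exact h x)

lemma linearIndependent_of_orthogonal {κ : Type*} {e : κ → E}
    (he : Pairwise fun i j => ⟪e i, e j⟫ = 0) (hm0 : 0 < m) (hm : ∀ k, m ≤ ‖e k‖ ^ 2) :
    LinearIndependent ℝ e := by
  refine linearIndependent_of_ne_zero_of_inner_eq_zero (𝕜 := ℝ) (fun k h0 => ?_) he
  have := hm k
  rw [h0] at this
  simp at this
  linarith

lemma second_eigenvalue_ge (hev : Antitone ev) (hA : ∀ i, A (b i) = ev i • b i) (hd : 0 ≤ d)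
    (hq : 0 ≤ q) (he : Pairwise fun i j => ⟪e i, e j⟫ = 0) (hm0 : 0 < m)
    (hm : ∀ k, m ≤ ‖e k‖ ^ 2) (hδ : ∀ x, ‖A x - blockMean d q e x‖ ≤ δ * ‖x‖) (hn : 1 < n) :
    d * m - δ ≤ ev ⟨1, hn⟩ := by
  refine le_eigenvalue_of_forall_combination hev hA hn e
    (linearIndependent_of_orthogonal he hm0 hm) fun c => ?_
  have h1 := le_inner_blockMean_combination hd hq he hm c
  have h2 := (abs_le.1 (abs_inner_sub_le hδ (∑ i, c i • e i))).1
  linarith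

/-- Beyond the first two, the eigenvalues of a perturbation of a rank-two positive semidefinite
operator are no larger than the perturbation. -/
lemma abs_eigenvalue_le (hev : Antitone ev) (hA : ∀ i, A (b i) = ev i • b i) (hd : 0 ≤ d)
    (hq : 0 ≤ q) (hδ : ∀ x, ‖A x - blockMean d q e x‖ ≤ δ * ‖x‖) (i : Fin n) (hi : 2 ≤ i.1) :
    |ev i| ≤ δ := by
  refine abs_le.2 ⟨?_, ?_⟩
  · have h2 := (abs_le.1 (abs_inner_sub_le hδ (b i))).1
    have h3 : 0 ≤ ⟪blockMean d q e (b i), b i⟫ := by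
      rw [inner_blockMean_self]
      exact add_nonneg (mul_nonneg hd (Finset.sum_nonneg fun _ _ => sq_nonneg _))
        (mul_nonneg hq (sq_nonneg _))
    rw [hA, inner_smul_left, real_inner_self_eq_norm_sq, b.norm_eq_one, conj_trivial] at h2
    linarith
  · have hn : 2 < n := by omega
    refine (hev (show (⟨2, hn⟩ : Fin n) ≤ i from hi)).trans ?_
    refine eigenvalue_le_of_forall_orthogonal hev hA hn e fun t ht => ?_
    have h2 := (abs_le.1 (abs_inner_sub_le hδ t)).2
    rw [inner_blockMean_self] at h2
    simp only [ht, sum_inner] at h2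
    simpa using h2

variable (hu : ∀ (k : Fin 2) (hk : k.1 < n), u k = b ⟨k.1, hk⟩)

include hu

/-- The projection off the two leading eigenvectors nearly annihilates the community vectors: it
reduces a vector of norm about `√m` to norm at most `2 δ / (d √m)`. On the range of the projection
the operator itself is at most `δ`, hence the mean is at most `2 δ`, whereas the mean stretches the
component along the communities by at least `d m`. -/
lemma norm_offProj_community_le (hev : Antitone ev) (hA : ∀ i, A (b i) = ev i • b i) (hd : 0 < d)
    (hq : 0 ≤ q) (huo : Orthonormal ℝ u)
    (he : Pairwise fun i j => ⟪e i, e j⟫ = 0) (hm0 : 0 < m) (hm : ∀ k, m ≤ ‖e k‖ ^ 2)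
    (hδ0 : 0 ≤ δ) (hδ : ∀ x, ‖A x - blockMean d q e x‖ ≤ δ * ‖x‖) (k : Fin 2) :
    ‖offProj u (e k)‖ ≤ 2 * δ / (d * √m) := by
  set t := offProj u (e k) with ht
  have hAt : ‖A t‖ ≤ δ * ‖t‖ := by
    refine le_of_sq_le_sq ?_ (by positivity)
    rw [norm_apply_sq_eq_sum_eigenvalues b hA, mul_pow, ← b.sum_sq_inner_right, Finset.mul_sum]
    refine Finset.sum_le_sum fun i _ => ?_
    rcases lt_or_ge i.1 2 with hi | hi
    · have h0 : ⟪b i, t⟫ = 0 := by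
        have := inner_offProj_of_orthonormal huo (e k) ⟨i.1, hi⟩
        rwa [hu _ i.2] at this
      simp [h0]
    · refine mul_le_mul_of_nonneg_right ?_ (sq_nonneg _)
      exact sq_le_sq.2 ((abs_eigenvalue_le hev hA hd.le hq hδ i hi).trans (le_abs_self δ))
  have hmean : ‖blockMean d q e t‖ ≤ 2 * δ * ‖t‖ := by
    have h1 : blockMean d q e t = A t - (A t - blockMean d q e t) := by abel
    rw [h1]
    exact (norm_sub_le _ _).trans (by linarith [hδ t])
  have h2 := le_norm_blockMean_sq hd.le hq he hm0.le hm t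
  have h3 : ⟪e k, t⟫ ^ 2 ≤ ∑ j, ⟪e j, t⟫ ^ 2 :=
    Finset.single_le_sum (f := fun j => ⟪e j, t⟫ ^ 2) (fun _ _ => sq_nonneg _) (Finset.mem_univ k)
  rw [ht, inner_offProj_self huo, ← ht] at h3
  have h4 : (d * √m * ‖t‖ ^ 2) ^ 2 ≤ (2 * δ * ‖t‖) ^ 2 := by
    calc (d * √m * ‖t‖ ^ 2) ^ 2 = m * d ^ 2 * (‖t‖ ^ 2) ^ 2 := by
          rw [mul_pow, mul_pow, Real.sq_sqrt hm0.le]; ring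
      _ ≤ m * d ^ 2 * ∑ j, ⟪e j, t⟫ ^ 2 := by gcongr
      _ ≤ ‖blockMean d q e t‖ ^ 2 := h2
      _ ≤ _ := by gcongr
  have h5 := le_of_sq_le_sq h4 (by positivity)
  have hsm : 0 < √m := Real.sqrt_pos.2 hm0
  rcases eq_or_ne ‖t‖ 0 with h0 | h0
  · rw [h0]; positivity
  · rw [le_div_iff₀ (by positivity)]
    have : 0 < ‖t‖ := lt_of_le_of_ne (norm_nonneg _) (Ne.symm h0)
    refine le_of_mul_le_mul_right ?_ this
    nlinarith

/-- A vector orthogonal to the communities is almost orthogonal to the two leading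
eigenvectors. -/
lemma norm_sub_offProj_le (hev : Antitone ev) (hA : ∀ i, A (b i) = ev i • b i) (hd : 0 < d)
    (hq : 0 ≤ q) (huo : Orthonormal ℝ u) (hn : 1 < n)
    (he : Pairwise fun i j => ⟪e i, e j⟫ = 0) (hm0 : 0 < m) (hm : ∀ k, m ≤ ‖e k‖ ^ 2)
    (hδ : ∀ x, ‖A x - blockMean d q e x‖ ≤ δ * ‖x‖) (hδm : δ ≤ d * m / 2)
    {z : E} (hz : ∀ k, ⟪e k, z⟫ = 0) :
    ‖z - offProj u z‖ ≤ 2 * δ / (d * m) * ‖z‖ := by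
  have hev1 : d * m / 2 ≤ ev ⟨1, hn⟩ := by
    linarith [second_eigenvalue_ge hev hA hd.le hq he hm0 hm hδ hn]
  have hev0 : d * m / 2 ≤ ev ⟨0, by omega⟩ := hev1.trans (hev (by simp))
  have hAz : ‖A z‖ ≤ δ * ‖z‖ := by
    have := hδ z
    rw [blockMean_apply] at this
    simpa [hz, inner_add_left] using this
  have hdm : 0 < d * m := by positivity
  have h1 : (d * m / 2 * ‖z - offProj u z‖) ^ 2 ≤ ‖A z‖ ^ 2 := by
    have h01 : (⟨0, by omega⟩ : Fin n) ≠ ⟨1, hn⟩ := by simp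
    rw [mul_pow, norm_sub_offProj_sq huo, norm_apply_sq_eq_sum_eigenvalues b hA,
      hu 0 (by simp; omega), hu 1 hn]
    calc _ = ∑ i ∈ {(⟨0, by omega⟩ : Fin n), ⟨1, hn⟩}, (d * m / 2) ^ 2 * ⟪b i, z⟫ ^ 2 := by
          rw [Finset.sum_pair h01]
          simp [mul_add]
      _ ≤ ∑ i ∈ {(⟨0, by omega⟩ : Fin n), ⟨1, hn⟩}, ev i ^ 2 * ⟪b i, z⟫ ^ 2 := by
          refine Finset.sum_le_sum fun i hi => mul_le_mul_of_nonneg_right ?_ (sq_nonneg _)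
          refine pow_le_pow_left₀ (by positivity) ?_ 2
          rcases Finset.mem_insert.1 hi with rfl | hi
          · exact hev0
          · rw [Finset.mem_singleton.1 hi]; exact hev1
      _ ≤ _ := Finset.sum_le_sum_of_subset_of_nonneg (Finset.subset_univ _)
          fun _ _ _ => by positivity
  have h2 := (le_of_sq_le_sq h1 (norm_nonneg _)).trans hAz
  rw [div_mul_eq_mul_div, le_div_iff₀ hdm]
  linarith

end Perturbation

/-! ### Distance up to sign -/

section SignDist

variable {E : Type*} [NormedAddCommGroup E]

/-- The distance between two vectors up to the sign of one of them. -/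
noncomputable def signDist (x y : E) : ℝ := min ‖x - y‖ ‖x + y‖

lemma signDist_comm (x y : E) : signDist x y = signDist y x := by
  rw [signDist, signDist, norm_sub_rev, add_comm]

lemma signDist_triangle (x y z : E) : signDist x z ≤ signDist x y + signDist y z := by
  have h1 : ‖x - z‖ ≤ ‖x - y‖ + ‖y - z‖ := norm_sub_le_norm_sub_add_norm_sub x y z
  have h2 : ‖x + z‖ ≤ ‖x - y‖ + ‖y + z‖ := by
    rw [show x + z = (x - y) + (y + z) by abel]; exact norm_add_le _ _
  have h3 : ‖x + z‖ ≤ ‖x + y‖ + ‖y - z‖ := by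
    rw [show x + z = (x + y) - (y - z) by abel]; exact norm_sub_le _ _
  have h4 : ‖x - z‖ ≤ ‖x + y‖ + ‖y + z‖ := by
    rw [show x - z = (x + y) - (y + z) by abel]; exact norm_sub_le _ _
  unfold signDist
  rcases min_choice ‖x - y‖ ‖x + y‖ with h | h <;>
    rcases min_choice ‖y - z‖ ‖y + z‖ with h' | h' <;> rw [h, h']
  · exact (min_le_left _ _).trans h1
  · exact (min_le_right _ _).trans h2
  · exact (min_le_right _ _).trans h3
  · exact (min_le_left _ _).trans h4

lemma signDist_le_two {x y : E} (hx : ‖x‖ = 1) (hy : ‖y‖ = 1) : signDist x y ≤ 2 :=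
  (min_le_left _ _).trans ((norm_sub_le _ _).trans (by rw [hx, hy]; norm_num))

variable [InnerProductSpace ℝ E]

/-- The sine of the angle between two lines controls the distance of their unit vectors. -/
lemma signDist_le_two_mul {x y : E} (hx : ‖x‖ = 1) (hy : ‖y‖ = 1) :
    signDist x y ≤ 2 * ‖x - ⟪y, x⟫ • y‖ := by
  have hc : |⟪y, x⟫| ≤ 1 := by simpa [hx, hy] using abs_real_inner_le_norm y x
  have hs : ‖x - ⟪y, x⟫ • y‖ ^ 2 = 1 - ⟪y, x⟫ ^ 2 := by
    rw [norm_sub_sq_real, norm_smul, inner_smul_right, real_inner_comm y x, hx, hy,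
      Real.norm_eq_abs, mul_one, sq_abs]
    ring
  have h1 : ‖x - y‖ ^ 2 = 2 - 2 * ⟪y, x⟫ := by
    rw [norm_sub_sq_real, hx, hy, real_inner_comm]; ring
  have h2 : ‖x + y‖ ^ 2 = 2 + 2 * ⟪y, x⟫ := by
    rw [norm_add_sq_real, hx, hy, real_inner_comm]; ring
  obtain ⟨hl, hr⟩ := abs_le.1 hc
  rcases le_total 0 ⟪y, x⟫ with h | h
  · refine (min_le_left _ _).trans (le_of_sq_le_sq ?_ (by positivity))
    rw [mul_pow, hs, h1]; nlinarith
  · refine (min_le_right _ _).trans (le_of_sq_le_sq ?_ (by positivity))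
    rw [mul_pow, hs, h2]; nlinarith

/-- Eigenvector perturbation around a rank-one operator `θ z zᵀ`. -/
lemma signDist_leading_eigenvector_le {M : E → E} {w z : E} {ev θ κ : ℝ} (hw : ‖w‖ = 1)
    (hz : ‖z‖ = 1) (hθ : 0 < θ) (hMw : M w = ev • w) (hmax : ⟪M z, z⟫ ≤ ev)
    (hM : ∀ x, ‖M x - (θ * ⟪z, x⟫) • z‖ ≤ κ * ‖x‖) : signDist w z ≤ 4 * κ / θ := by
  rcases le_or_gt θ (2 * κ) with hκ | hκ
  · refine (signDist_le_two hw hz).trans ?_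
    rw [le_div_iff₀ hθ]; linarith
  have hev : θ - κ ≤ ev := by
    have h1 := (abs_le.1 ((abs_real_inner_le_norm _ z).trans
      (mul_le_mul_of_nonneg_right (hM z) (norm_nonneg z)))).1
    rw [inner_sub_left, inner_smul_left, real_inner_self_eq_norm_sq, hz] at h1
    simp at h1
    linarith
  have hev0 : θ / 2 ≤ ev := by linarith
  -- The component of `w` orthogonal to `z`, scaled by `ev`, is that of `M w - θ ⟪z, w⟫ z`.
  have h2 : ev * ‖w - ⟪z, w⟫ • z‖ ≤ κ := by
    set f := M w - (θ * ⟪z, w⟫) • z with hf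
    have h3 : ev • (w - ⟪z, w⟫ • z) = f - ⟪z, f⟫ • z := by
      rw [hf, hMw, inner_sub_right, inner_smul_right, inner_smul_right,
        real_inner_self_eq_norm_sq, hz]
      module
    have h4 : ‖f - ⟪z, f⟫ • z‖ ≤ ‖f‖ := by
      refine le_of_sq_le_sq ?_ (norm_nonneg _)
      rw [norm_sub_sq_real, norm_smul, inner_smul_right, real_inner_comm z f, hz,
        Real.norm_eq_abs, mul_one, sq_abs]
      nlinarith [sq_nonneg ⟪z, f⟫]
    have h5 : ‖ev • (w - ⟪z, w⟫ • z)‖ = ev * ‖w - ⟪z, w⟫ • z‖ := by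
      rw [norm_smul, Real.norm_of_nonneg (by linarith)]
    rw [← h5, h3]
    exact h4.trans ((hM w).trans (by rw [hw, mul_one]))
  refine (signDist_le_two_mul hw hz).trans ?_
  rw [le_div_iff₀ hθ]
  nlinarith [norm_nonneg (w - ⟪z, w⟫ • z)]

end SignDist

/-! ### Three communities -/

section ThreeCommunities

variable {E : Type*} [NormedAddCommGroup E] [InnerProductSpace ℝ E] {d q l s : ℝ} {e : Fin 3 → E}

/-- The direction orthogonal to `e₀` and `e₁ + e₂` in the span of three orthogonal community
vectors, where `‖e₁‖ ^ 2 = l` and `‖e₂‖ ^ 2 = s`. -/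
def splitVec (l s : ℝ) (e : Fin 3 → E) : E := l • e 2 - s • e 1

lemma norm_splitVec_sq (he : Pairwise fun i j => ⟪e i, e j⟫ = 0) (h1 : ‖e 1‖ ^ 2 = l)
    (h2 : ‖e 2‖ ^ 2 = s) : ‖splitVec l s e‖ ^ 2 = l * s * (l + s) := by
  rw [splitVec, norm_sub_sq_real, norm_smul, norm_smul, inner_smul_left, inner_smul_right,
    he (by decide : (2 : Fin 3) ≠ 1), mul_pow, mul_pow, h1, h2, Real.norm_eq_abs, Real.norm_eq_abs,
    sq_abs, sq_abs]
  ring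

lemma inner_zero_splitVec (he : Pairwise fun i j => ⟪e i, e j⟫ = 0) :
    ⟪e 0, splitVec l s e⟫ = 0 := by
  rw [splitVec, inner_sub_right, inner_smul_right, inner_smul_right,
    he (by decide : (0 : Fin 3) ≠ 1), he (by decide : (0 : Fin 3) ≠ 2)]
  ring

lemma inner_add_splitVec (he : Pairwise fun i j => ⟪e i, e j⟫ = 0) (h1 : ‖e 1‖ ^ 2 = l)
    (h2 : ‖e 2‖ ^ 2 = s) : ⟪e 1 + e 2, splitVec l s e⟫ = 0 := by
  rw [splitVec, inner_sub_right, inner_smul_right, inner_smul_right, inner_add_left,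
    inner_add_left, real_inner_self_eq_norm_sq, real_inner_self_eq_norm_sq,
    he (by decide : (1 : Fin 3) ≠ 2), he (by decide : (2 : Fin 3) ≠ 1), h1, h2]
  ring

lemma norm_inner_smul_le (u v x : E) : ‖⟪u, x⟫ • v‖ ≤ ‖u‖ * ‖v‖ * ‖x‖ := by
  rw [norm_smul, Real.norm_eq_abs]
  calc |⟪u, x⟫| * ‖v‖ ≤ ‖u‖ * ‖x‖ * ‖v‖ := by gcongr; exact abs_real_inner_le_norm u x
    _ = _ := by ring

/-- Compressing the mean of three communities by a projection that nearly annihilates `e₀` and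
`e₁ + e₂` and nearly fixes the remaining direction `r = l e₂ - s e₁` leaves
`2 d / (l + s) ^ 2 • r rᵀ` up to a small error. This follows by substituting
`e₁ = (l (e₁ + e₂) - r) / (l + s)` and `e₂ = (s (e₁ + e₂) + r) / (l + s)`. -/
lemma norm_compression_mean_sub_le (hl : 0 < l) (hs : 0 < s) (hsl : s ≤ l) (hd : 0 < d)
    (hd1 : d ≤ 1) (hq : 0 ≤ q) (hq1 : q ≤ 1) (he : Pairwise fun i j => ⟪e i, e j⟫ = 0)
    (h1 : ‖e 1‖ ^ 2 = l) (h2 : ‖e 2‖ ^ 2 = s) {Q : E →ₗ[ℝ] E}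
    (hQs : ∀ x y, ⟪Q x, y⟫ = ⟪x, Q y⟫) (hQn : ∀ x, ‖Q x‖ ≤ ‖x‖) {η ρ : ℝ}
    (hQ0 : ‖Q (e 0)‖ ≤ η) (hQ12 : ‖Q (e 1 + e 2)‖ ≤ η)
    (hQr : ‖splitVec l s e - Q (splitVec l s e)‖ ≤ ρ * ‖splitVec l s e‖) (x : E) :
    ‖Q (blockMean d q e (Q x)) -
        (2 * d / (l + s) ^ 2 * ⟪splitVec l s e, x⟫) • splitVec l s e‖ ≤
      (6 * η ^ 2 + 2 * η * √l + 4 * d * ρ * l) * ‖x‖ := by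
  set r := splitVec l s e with hr
  set g := e 1 + e 2 with hg
  set i := (l + s)⁻¹ with hi
  have hls : 0 < l + s := by positivity
  have hi0 : 0 < i := inv_pos.2 hls
  have hils : i * (l + s) = 1 := inv_mul_cancel₀ hls.ne'
  have he1 : e 1 = i • (l • g - r) := by
    have : l • g - r = (l + s) • e 1 := by rw [hg, hr, splitVec]; module
    rw [this, smul_smul, hils, one_smul]
  have he2 : e 2 = i • (s • g + r) := by
    have : s • g + r = (l + s) • e 2 := by rw [hg, hr, splitVec]; module
    rw [this, smul_smul, hils, one_smul]
  have key : Q (blockMean d q e (Q x)) - (2 * d / (l + s) ^ 2 * ⟪r, x⟫) • r =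
      d • (⟪Q (e 0), x⟫ • Q (e 0)) + (d * (i ^ 2 * (l ^ 2 + s ^ 2))) • (⟪Q g, x⟫ • Q g) +
      (-(d * (i ^ 2 * (l - s)))) • (⟪Q g, x⟫ • Q r + ⟪Q r, x⟫ • Q g) +
      (2 * d * i ^ 2) • (-(⟪Q r, x⟫ • (r - Q r)) - ⟪r - Q r, x⟫ • r) +
      q • (⟪Q (e 0) + Q g, x⟫ • (Q (e 0) + Q g)) := by
    have hsum : ∑ k, e k = e 0 + g := by rw [Fin.sum_univ_three, hg]; abel
    have hdiv : 2 * d / (l + s) ^ 2 = 2 * d * i ^ 2 := by rw [hi]; field_simp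
    have hsplit : blockMean d q e (Q x) =
        d • (⟪e 0, Q x⟫ • e 0 + ⟪e 1, Q x⟫ • e 1 + ⟪e 2, Q x⟫ • e 2) +
          (q * ⟪e 0 + g, Q x⟫) • (e 0 + g) := by
      rw [blockMean_apply, hsum, Fin.sum_univ_three, hg]
      module
    rw [hdiv, hsplit]
    have hQe0 : ⟪e 0, Q x⟫ = ⟪Q (e 0), x⟫ := (hQs _ _).symm
    have hQg : ⟪g, Q x⟫ = ⟪Q g, x⟫ := (hQs _ _).symm
    have hQr' : ⟪r, Q x⟫ = ⟪Q r, x⟫ := (hQs _ _).symm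
    rw [he1, he2]
    simp only [map_add, map_sub, map_smul, inner_add_left, inner_sub_left, inner_smul_left,
      conj_trivial, hQe0, hQg, hQr']
    module
  have hη : 0 ≤ η := (norm_nonneg _).trans hQ0
  have hR2 : ‖r‖ ^ 2 = l * s * (l + s) := norm_splitVec_sq he h1 h2
  have hρR : 0 ≤ ρ * ‖r‖ := (norm_nonneg _).trans hQr
  have hsq : i ^ 2 * (l + s) ^ 2 = 1 := by rw [← mul_pow, hils, one_pow]
  have hc2 : i ^ 2 * (l ^ 2 + s ^ 2) ≤ 1 := by nlinarith [mul_pos (pow_pos hi0 2) (mul_pos hl hs)]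
  have hc3 : i ^ 2 * (l - s) * ‖r‖ ≤ √l := by
    have hR : ‖r‖ ≤ √l * (l + s) := by
      refine le_of_sq_le_sq ?_ (by positivity)
      rw [hR2, mul_pow, Real.sq_sqrt hl.le]
      nlinarith [mul_pos hl hls]
    have h3 : i ^ 2 * (l - s) * (l + s) ≤ 1 := by
      nlinarith [mul_nonneg (sq_nonneg i) (mul_nonneg hs.le hls.le)]
    calc i ^ 2 * (l - s) * ‖r‖ ≤ i ^ 2 * (l - s) * (√l * (l + s)) := by
          refine mul_le_mul_of_nonneg_left hR (mul_nonneg (sq_nonneg _) (sub_nonneg.2 hsl))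
      _ = √l * (i ^ 2 * (l - s) * (l + s)) := by ring
      _ ≤ √l * 1 := by gcongr
      _ = √l := mul_one _
  have hc4 : i ^ 2 * ‖r‖ ^ 2 ≤ l := by
    calc i ^ 2 * ‖r‖ ^ 2 = l * (i * s) * (i * (l + s)) := by rw [hR2]; ring
      _ ≤ l := by
        rw [hils, mul_one]
        have : i * s ≤ 1 := by rw [← hils]; gcongr; linarith
        nlinarith
  have hρ : 0 ≤ ρ := by
    have : 0 < ‖r‖ := by
      have : 0 < ‖r‖ ^ 2 := by rw [hR2]; positivity
      exact lt_of_le_of_ne (norm_nonneg _) fun h0 => by simp [← h0] at this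
    exact nonneg_of_mul_nonneg_left hρR this
  have hX := norm_nonneg x
  have hQrn := hQn r
  rw [key]
  have t1 : ‖d • (⟪Q (e 0), x⟫ • Q (e 0))‖ ≤ 1 * (η * η * ‖x‖) := by
    rw [norm_smul, Real.norm_of_nonneg hd.le]
    gcongr
    exact (norm_inner_smul_le _ _ _).trans (by gcongr)
  have t2 : ‖(d * (i ^ 2 * (l ^ 2 + s ^ 2))) • (⟪Q g, x⟫ • Q g)‖ ≤ 1 * (η * η * ‖x‖) := by
    rw [norm_smul, Real.norm_of_nonneg (by positivity)]
    gcongr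
    · exact mul_le_one₀ hd1 (by positivity) hc2
    · exact (norm_inner_smul_le _ _ _).trans (by gcongr)
  have t3 : ‖(-(d * (i ^ 2 * (l - s)))) • (⟪Q g, x⟫ • Q r + ⟪Q r, x⟫ • Q g)‖ ≤
      2 * η * √l * ‖x‖ := by
    have hn : 0 ≤ i ^ 2 * (l - s) := mul_nonneg (sq_nonneg _) (sub_nonneg.2 hsl)
    rw [norm_smul, norm_neg, Real.norm_of_nonneg (mul_nonneg hd.le hn)]
    have h3 : ‖⟪Q g, x⟫ • Q r + ⟪Q r, x⟫ • Q g‖ ≤ η * ‖r‖ * ‖x‖ + ‖r‖ * η * ‖x‖ :=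
      (norm_add_le _ _).trans (add_le_add
        ((norm_inner_smul_le _ _ _).trans (by gcongr))
        ((norm_inner_smul_le _ _ _).trans (by gcongr)))
    calc _ ≤ 1 * (i ^ 2 * (l - s)) * (η * ‖r‖ * ‖x‖ + ‖r‖ * η * ‖x‖) := by gcongr
      _ = 2 * η * (i ^ 2 * (l - s) * ‖r‖) * ‖x‖ := by ring
      _ ≤ _ := by gcongr
  have t4 : ‖(2 * d * i ^ 2) • (-(⟪Q r, x⟫ • (r - Q r)) - ⟪r - Q r, x⟫ • r)‖ ≤
      4 * d * ρ * l * ‖x‖ := by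
    rw [norm_smul, Real.norm_of_nonneg (by positivity)]
    have h3 : ‖-(⟪Q r, x⟫ • (r - Q r)) - ⟪r - Q r, x⟫ • r‖ ≤
        ‖r‖ * (ρ * ‖r‖) * ‖x‖ + ρ * ‖r‖ * ‖r‖ * ‖x‖ :=
      (norm_sub_le _ _).trans (add_le_add
        (by rw [norm_neg]; exact (norm_inner_smul_le _ _ _).trans (by gcongr))
        ((norm_inner_smul_le _ _ _).trans (by gcongr)))
    calc _ ≤ 2 * d * i ^ 2 * (‖r‖ * (ρ * ‖r‖) * ‖x‖ + ρ * ‖r‖ * ‖r‖ * ‖x‖) := by gcongr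
      _ = 4 * d * ρ * (i ^ 2 * ‖r‖ ^ 2) * ‖x‖ := by ring
      _ ≤ _ := by gcongr
  have t5 : ‖q • (⟪Q (e 0) + Q g, x⟫ • (Q (e 0) + Q g))‖ ≤
      1 * ((η + η) * (η + η) * ‖x‖) := by
    have h3 : ‖Q (e 0) + Q g‖ ≤ η + η := (norm_add_le _ _).trans (add_le_add hQ0 hQ12)
    rw [norm_smul, Real.norm_of_nonneg hq]
    gcongr
    exact (norm_inner_smul_le _ _ _).trans (by gcongr)
  refine (norm_add_le _ _).trans ?_
  refine (add_le_add ((norm_add_le _ _).trans (add_le_add ((norm_add_le _ _).trans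
    (add_le_add ((norm_add_le _ _).trans (add_le_add t1 t2)) t3)) t4)) t5).trans ?_
  exact le_of_eq (by ring)

/-- The unit vector along `splitVec` is within `O(√(s / l))` of the normalised third community. -/
lemma signDist_normalized_splitVec_le (hl : 0 < l) (hs : 0 < s)
    (he : Pairwise fun i j => ⟪e i, e j⟫ = 0) (h1 : ‖e 1‖ ^ 2 = l) (h2 : ‖e 2‖ ^ 2 = s) :
    signDist (‖splitVec l s e‖⁻¹ • splitVec l s e) ((√s)⁻¹ • e 2) ≤ 2 * √(s / l) := by
  set r := splitVec l s e with hr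
  have hR2 : ‖r‖ ^ 2 = l * s * (l + s) := norm_splitVec_sq he h1 h2
  have hR0 : ‖r‖ ≠ 0 := fun h0 => by
    have : 0 < l * s * (l + s) := by positivity
    rw [← hR2, h0] at this
    simp at this
  have hsn : ‖e 2‖ = √s := by rw [← h2, Real.sqrt_sq (norm_nonneg _)]
  have hs0 : 0 < √s := Real.sqrt_pos.2 hs
  refine (signDist_le_two_mul (by rw [norm_smul, norm_inv, norm_norm, inv_mul_cancel₀ hR0])
    (by rw [norm_smul, Real.norm_of_nonneg (by positivity), hsn, inv_mul_cancel₀ hs0.ne'])).trans ?_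
  have hdiff : ‖r‖⁻¹ • r - ⟪(√s)⁻¹ • e 2, ‖r‖⁻¹ • r⟫ • (√s)⁻¹ • e 2 = (-(‖r‖⁻¹ * s)) • e 1 := by
    have hin : ⟪e 2, r⟫ = l * s := by
      rw [hr, splitVec, inner_sub_right, inner_smul_right, inner_smul_right,
        real_inner_self_eq_norm_sq, h2, he (by decide : (2 : Fin 3) ≠ 1)]
      ring
    rw [inner_smul_left, inner_smul_right, hin, conj_trivial, smul_smul,
      show (√s)⁻¹ * (‖r‖⁻¹ * (l * s)) * (√s)⁻¹ = ‖r‖⁻¹ * l by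
        field_simp; rw [Real.sq_sqrt hs.le], hr, splitVec]
    module
  have hsq : ‖(-(‖r‖⁻¹ * s)) • e 1‖ ^ 2 ≤ (√(s / l)) ^ 2 := by
    rw [norm_smul, norm_neg, mul_pow, h1, Real.sq_sqrt (by positivity), Real.norm_eq_abs, sq_abs,
      mul_pow, inv_pow, hR2, inv_mul_eq_div, div_mul_eq_mul_div, div_le_div_iff₀ (by positivity) hl]
    nlinarith [mul_pos (mul_pos hs hs) (mul_pos hl hl), mul_pos hl hs,
      mul_pos (mul_pos hs hs) (mul_pos hl hs)]
  rw [hdiff]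
  linarith [le_of_sq_le_sq hsq (by positivity)]

/-- Bessel's inequality for orthogonal vectors that are not normalised. -/
lemma sum_inner_sq_div_le (he : Pairwise fun i j => ⟪e i, e j⟫ = 0) (he0 : ∀ k, e k ≠ 0) (x : E) :
    ∑ k, ⟪e k, x⟫ ^ 2 / ‖e k‖ ^ 2 ≤ ‖x‖ ^ 2 := by
  have hon : Orthonormal ℝ fun k => ‖e k‖⁻¹ • e k := by
    refine ⟨fun k => ?_, fun i j hij => ?_⟩
    · rw [norm_smul, norm_inv, norm_norm, inv_mul_cancel₀ (norm_ne_zero_iff.2 (he0 k))]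
    · change ⟪‖e i‖⁻¹ • e i, ‖e j‖⁻¹ • e j⟫ = 0
      rw [inner_smul_left, inner_smul_right, he hij]; simp
  refine le_trans (le_of_eq ?_) (hon.sum_inner_products_le (s := Finset.univ) x)
  refine Finset.sum_congr rfl fun k _ => ?_
  rw [inner_smul_left, conj_trivial, norm_mul, norm_inv, norm_norm, Real.norm_eq_abs, mul_pow,
    sq_abs, inv_pow, div_eq_inv_mul]

/-- The third eigenvector of the mean is within `O(√(s / l))` of the normalised third community.
Its eigenvalue lies strictly between `0` and `d l`; this forces equal components along the two large
communities, and makes them small. -/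
lemma signDist_third_eigenvector_le {n : ℕ} {b : OrthonormalBasis (Fin n) ℝ E} {ev : Fin n → ℝ}
    (hev : Antitone ev) (hb : ∀ i, blockMean d q e (b i) = ev i • b i) (hn : 2 < n)
    (hs : 0 < s) (hsl : s < l) (hd : 0 < d) (hq : 0 ≤ q)
    (he : Pairwise fun i j => ⟪e i, e j⟫ = 0) (h0 : ‖e 0‖ ^ 2 = l) (h1 : ‖e 1‖ ^ 2 = l)
    (h2 : ‖e 2‖ ^ 2 = s) :
    signDist (b ⟨2, hn⟩) ((√s)⁻¹ • e 2) ≤ 2 * √(s / l) := by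
  have hl : 0 < l := hs.trans hsl
  have hsk : ∀ k, s ≤ ‖e k‖ ^ 2 := by
    intro k; fin_cases k
    exacts [h0 ▸ hsl.le, h1 ▸ hsl.le, h2.ge]
  have he0 : ∀ k, e k ≠ 0 := fun k hk => by
    have := hsk k
    rw [hk] at this
    simp at this
    linarith
  have hpos : 0 < ev ⟨2, hn⟩ := by
    have : d * s ≤ ev ⟨2, hn⟩ :=
      le_eigenvalue_of_forall_combination hev hb hn e
        (linearIndependent_of_orthogonal he hs hsk)
        (le_inner_blockMean_combination hd.le hq he hsk)
    have : 0 < d * s := by positivity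
    linarith
  -- The maximum of the Rayleigh quotient on the complement of `e₀ + e₁ + e₂` and `e₀ - e₁`.
  have hlt : ev ⟨2, hn⟩ < d * l := by
    have hle : ev ⟨2, hn⟩ ≤ d * (3 * l * s / (s + 2 * l)) := by
      refine eigenvalue_le_of_forall_orthogonal hev hb hn ![∑ k, e k, e 0 - e 1] fun t ht => ?_
      have ht0 : ⟪∑ k, e k, t⟫ = 0 := ht 0
      have ht1 : ⟪e 0 - e 1, t⟫ = 0 := ht 1
      rw [inner_blockMean_self, ht0]
      rw [Fin.sum_univ_three, inner_add_left, inner_add_left] at ht0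
      rw [inner_sub_left] at ht1
      have hB := sum_inner_sq_div_le he he0 t
      rw [Fin.sum_univ_three, h0, h1, h2] at hB
      rw [Fin.sum_univ_three]
      have e1 : ⟪e 1, t⟫ = ⟪e 0, t⟫ := by linarith
      have e2 : ⟪e 2, t⟫ = -2 * ⟪e 0, t⟫ := by linarith
      rw [e1, e2] at hB ⊢
      have h3 : 6 * ⟪e 0, t⟫ ^ 2 ≤ 3 * l * s / (s + 2 * l) * ‖t‖ ^ 2 := by
        calc 6 * ⟪e 0, t⟫ ^ 2 = 3 * l * s / (s + 2 * l) *
              (⟪e 0, t⟫ ^ 2 / l + ⟪e 0, t⟫ ^ 2 / l + (-2 * ⟪e 0, t⟫) ^ 2 / s) := by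
              field_simp; ring
          _ ≤ _ := by gcongr
      nlinarith [mul_le_mul_of_nonneg_left h3 hd.le]
    refine hle.trans_lt (mul_lt_mul_of_pos_left ?_ hd)
    rw [div_lt_iff₀ (by positivity)]
    nlinarith
  set v := b ⟨2, hn⟩ with hv
  set L := ev ⟨2, hn⟩ with hL
  have hvL : blockMean d q e v = L • v := hb _
  have hv1 : ‖v‖ = 1 := b.norm_eq_one _
  set S := ⟪∑ k, e k, v⟫ with hS
  have hS3 : S = ⟪e 0, v⟫ + ⟪e 1, v⟫ + ⟪e 2, v⟫ := by
    rw [hS, Fin.sum_univ_three, inner_add_left, inner_add_left]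
  have hcoord : ∀ k, L * ⟪e k, v⟫ = (d * ⟪e k, v⟫ + q * S) * ‖e k‖ ^ 2 := fun k => by
    rw [← inner_smul_right, ← hvL, blockMean_apply, inner_sum_smul_of_orthogonal he]
  have c0 := hcoord 0
  have c1 := hcoord 1
  have c2 := hcoord 2
  rw [h0] at c0
  rw [h1] at c1
  rw [h2] at c2
  have hray : L = d * ∑ k, ⟪e k, v⟫ ^ 2 + q * S ^ 2 := by
    rw [hS, ← inner_blockMean_self, hvL, inner_smul_left, real_inner_self_eq_norm_sq, hv1]
    simp
  rw [Fin.sum_univ_three] at hray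
  set x := ⟪e 0, v⟫
  set y := ⟪e 1, v⟫
  set z := ⟪e 2, v⟫ with hz
  have hxy : x = y := by
    have h3 : (L - d * l) * (x - y) = 0 := by linarith
    rcases mul_eq_zero.1 h3 with h | h <;> linarith
  have hnorm : 1 = 2 * x ^ 2 / l + z ^ 2 / s := by
    have h3 : L * 1 = L * (2 * x ^ 2 / l + z ^ 2 / s) := by
      calc L * 1 = x * (d * x + q * S) + y * (d * y + q * S) + z * (d * z + q * S) := by
            rw [mul_one, hray, hS3]; ring
        _ = x * (L * x / l) + x * (L * x / l) + z * (L * z / s) := by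
            rw [← hxy, c0, c2]; field_simp
        _ = _ := by ring
    exact mul_left_cancel₀ hpos.ne' h3
  have hxz : 4 * x ^ 2 ≤ z ^ 2 := by
    have h3 : ((d + 2 * q) * l - L) * x = -(q * l * z) := by
      rw [hS3, ← hxy] at c0; linarith
    rcases hq.eq_or_lt with hq0 | hq0
    · have h4 : (d * l - L) * x = 0 := by rw [← hq0] at h3; linarith
      have : x = 0 := (mul_eq_zero.1 h4).resolve_left (by linarith)
      rw [this]; nlinarith [sq_nonneg z]
    · have h5 : 2 * (q * l) ≤ (d + 2 * q) * l - L := by nlinarith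
      have h6 : (2 * (q * l)) ^ 2 * x ^ 2 ≤ (q * l) ^ 2 * z ^ 2 := by
        calc (2 * (q * l)) ^ 2 * x ^ 2 ≤ ((d + 2 * q) * l - L) ^ 2 * x ^ 2 := by gcongr
          _ = (((d + 2 * q) * l - L) * x) ^ 2 := by ring
          _ = _ := by rw [h3]; ring
      have h7 : 0 < (q * l) ^ 2 := by positivity
      nlinarith
  have hs0 : 0 < √s := Real.sqrt_pos.2 hs
  have hsn : ‖e 2‖ = √s := by rw [← h2, Real.sqrt_sq (norm_nonneg _)]
  have hgn : ‖(√s)⁻¹ • e 2‖ = 1 := by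
    rw [norm_smul, Real.norm_of_nonneg (by positivity), hsn, inv_mul_cancel₀ hs0.ne']
  refine (signDist_le_two_mul hv1 hgn).trans ?_
  have hsq : ‖v - ⟪(√s)⁻¹ • e 2, v⟫ • (√s)⁻¹ • e 2‖ ^ 2 ≤ √(s / l) ^ 2 := by
    rw [norm_sub_sq_real, norm_smul, inner_smul_right,
      real_inner_comm ((√s)⁻¹ • e 2) v, hv1, hgn, inner_smul_left,
      ← hz, Real.norm_eq_abs, mul_one, sq_abs, conj_trivial, Real.sq_sqrt (by positivity)]
    have h3 : z ^ 2 / s ≤ 1 := by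
      have : 0 ≤ 2 * x ^ 2 / l := by positivity
      linarith
    have h4 : z ^ 2 ≤ s := by rwa [div_le_one hs] at h3
    have h5 : (√s)⁻¹ ^ 2 = s⁻¹ := by rw [inv_pow, Real.sq_sqrt hs.le]
    calc _ = 1 - z ^ 2 / s := by
          rw [div_eq_inv_mul, ← h5]; ring_nf
      _ = 2 * x ^ 2 / l := by linarith
      _ ≤ s / l := by gcongr; linarith [sq_nonneg x]
  linarith [le_of_sq_le_sq hsq (by positivity)]

end ThreeCommunities

/-! ### The compressed matrix -/

section Compression

variable {E : Type*} [NormedAddCommGroup E] [InnerProductSpace ℝ E] {d q l s : ℝ} {e : Fin 3 → E}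

/-- The leading eigenvector of `Q B Q`, where `Q` projects off the two leading eigenvectors of a
perturbation `A` of the mean with communities `e₀` and `e₁ + e₂`, and `B` is a perturbation of the
mean with communities `e₀`, `e₁`, `e₂`. Both perturbations have norm at most `16 √l`. -/
lemma signDist_compression_le {n : ℕ} (hn : 1 < n) {b : OrthonormalBasis (Fin n) ℝ E}
    {ev : Fin n → ℝ} {A B : E →ₗ[ℝ] E} (hev : Antitone ev) (hA : ∀ i, A (b i) = ev i • b i)
    {u : Fin 2 → E} (hu : ∀ (k : Fin 2) (hk : k.1 < n), u k = b ⟨k.1, hk⟩)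
    (hl : 1 ≤ l) (hs : 0 < s) (hsl : s ≤ l) (hd : 0 < d) (hd1 : d ≤ 1) (hq : 0 ≤ q) (hq1 : q ≤ 1)
    (he : Pairwise fun i j => ⟪e i, e j⟫ = 0) (h0 : ‖e 0‖ ^ 2 = l) (h1 : ‖e 1‖ ^ 2 = l)
    (h2 : ‖e 2‖ ^ 2 = s)
    (hAδ : ∀ x, ‖A x - blockMean d q ![e 0, e 1 + e 2] x‖ ≤ 16 * √l * ‖x‖)
    (hBδ : ∀ x, ‖B x - blockMean d q e x‖ ≤ 16 * √l * ‖x‖)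
    {w : E} {evw : ℝ} (hw : ‖w‖ = 1) (hMw : offProj u (B (offProj u w)) = evw • w)
    (hmax : ∀ x, ⟪offProj u (B (offProj u x)), x⟫ ≤ evw * ‖x‖ ^ 2) :
    signDist w (‖splitVec l s e‖⁻¹ • splitVec l s e) ≤ 25600 / d ^ 3 * (√l / s) := by
  have hl0 : 0 < l := by linarith
  have hsl1 : 1 ≤ √l := Real.one_le_sqrt.2 hl
  have hsl2 : √l ^ 2 = l := Real.sq_sqrt hl0.le
  set r := splitVec l s e with hr
  have hR2 : ‖r‖ ^ 2 = l * s * (l + s) := norm_splitVec_sq he h1 h2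
  have hR0 : ‖r‖ ≠ 0 := fun h => by
    have : 0 < l * s * (l + s) := by positivity
    rw [← hR2, h] at this
    simp at this
  have hz : ‖‖r‖⁻¹ • r‖ = 1 := by rw [norm_smul, norm_inv, norm_norm, inv_mul_cancel₀ hR0]
  -- If the spectral gap of `A` is not larger than the noise, the claimed bound exceeds `2`.
  rcases lt_or_ge (d * l / 2) (16 * √l) with hgap | hgap
  · refine (signDist_le_two hw hz).trans ?_
    have h3 : d * √l < 32 := by
      have : d * √l * √l < 32 * √l := by rw [mul_assoc, ← sq, hsl2]; linarith
      exact lt_of_mul_lt_mul_right this (by positivity)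
    rw [div_mul_div_comm, le_div_iff₀ (by positivity)]
    have hd3 : d ^ 2 ≤ 1 := pow_le_one₀ hd.le hd1
    calc 2 * (d ^ 3 * s) ≤ 2 * (d ^ 3 * l) := by gcongr
      _ = 2 * d ^ 2 * (d * √l) * √l := by rw [← hsl2]; ring_nf; rw [Real.sqrt_sq (by positivity)]
      _ ≤ 2 * 1 * 32 * √l := by gcongr
      _ ≤ 25600 * √l := by linarith
  have huo : Orthonormal ℝ u := by
    have : u = fun k : Fin 2 => b ⟨k.1, by omega⟩ := funext fun k => hu k _
    rw [this]
    exact b.orthonormal.comp _ fun i j hij => Fin.ext (by simpa using hij)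
  set f : Fin 2 → E := ![e 0, e 1 + e 2] with hf
  have h0g : ⟪e 0, e 1 + e 2⟫ = 0 := by
    rw [inner_add_right, he (by decide : (0 : Fin 3) ≠ 1), he (by decide : (0 : Fin 3) ≠ 2),
      add_zero]
  have hfo : Pairwise fun i j => ⟪f i, f j⟫ = 0 := by
    intro i j hij
    fin_cases i <;> fin_cases j <;> simp [hf] at hij ⊢
    · exact h0g
    · rw [real_inner_comm]; exact h0g
  have hfl : ∀ k, l ≤ ‖f k‖ ^ 2 := by
    intro k
    fin_cases k
    · exact h0.ge
    · change l ≤ ‖e 1 + e 2‖ ^ 2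
      rw [norm_add_sq_real, he (by decide : (1 : Fin 3) ≠ 2), h1, h2]
      linarith
  have hcomm := norm_offProj_community_le hu hev hA hd hq huo hfo hl0 hfl (by positivity) hAδ
  have hη : 2 * (16 * √l) / (d * √l) = 32 / d := by field_simp; norm_num
  rw [hη] at hcomm
  have hQr : ‖r - offProj u r‖ ≤ 2 * (16 * √l) / (d * l) * ‖r‖ := by
    refine norm_sub_offProj_le hu hev hA hd hq huo hn hfo hl0 hfl hAδ hgap fun k => ?_
    fin_cases k
    · exact inner_zero_splitVec he
    · exact inner_add_splitVec he h1 h2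
  have hmean := norm_compression_mean_sub_le hl0 hs hsl hd hd1 hq hq1 he h1 h2
    (inner_offProj_left u) (norm_offProj_le huo) (hcomm 0) (hcomm 1) hQr
  set θ := 2 * d / (l + s) ^ 2 * ‖r‖ ^ 2 with hθ
  have hθs : d * s ≤ θ := by
    rw [hθ, hR2, div_mul_eq_mul_div, le_div_iff₀ (by positivity)]
    have : d * s * (l + s) * (l + s) ≤ d * s * (l + s) * (2 * l) := by gcongr; linarith
    linarith
  have hds : 0 < d * s := by positivity
  have hM : ∀ x, ‖offProj u (B (offProj u x)) -
      (θ * ⟪‖r‖⁻¹ • r, x⟫) • ‖r‖⁻¹ • r‖ ≤ 6400 / d ^ 2 * √l * ‖x‖ := by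
    intro x
    have h3 : (θ * ⟪‖r‖⁻¹ • r, x⟫) • ‖r‖⁻¹ • r = (2 * d / (l + s) ^ 2 * ⟪r, x⟫) • r := by
      rw [inner_smul_left, conj_trivial, smul_smul, hθ]
      congr 1
      field_simp
    have h4 : offProj u (B (offProj u x)) - (2 * d / (l + s) ^ 2 * ⟪r, x⟫) • r =
        offProj u (B (offProj u x) - blockMean d q e (offProj u x)) +
        (offProj u (blockMean d q e (offProj u x)) - (2 * d / (l + s) ^ 2 * ⟪r, x⟫) • r) := by
      rw [map_sub]; abel
    have h5 : ‖offProj u (B (offProj u x) - blockMean d q e (offProj u x))‖ ≤ 16 * √l * ‖x‖ :=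
      (norm_offProj_le huo _).trans ((hBδ _).trans (by gcongr; exact norm_offProj_le huo x))
    rw [h3, h4]
    refine (norm_add_le _ _).trans ((add_le_add h5 (hmean x)).trans ?_)
    rw [← add_mul]
    refine mul_le_mul_of_nonneg_right ?_ (norm_nonneg x)
    have h6 : 4 * d * (2 * (16 * √l) / (d * l)) * l = 128 * √l := by field_simp; norm_num
    rw [h6]
    -- In terms of `y = 1 / d ≥ 1` every error term is a multiple of `y ^ 2 √l`.
    set y := 1 / d with hy
    have hy1 : 1 ≤ y := by rw [hy, le_div_iff₀ hd]; linarith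
    have h7 : 32 / d = 32 * y := by rw [hy]; ring
    have h8 : 6400 / d ^ 2 = 6400 * y ^ 2 := by rw [hy]; ring
    rw [h7, h8]
    have h9 : y ≤ y ^ 2 := by nlinarith
    have h10 : y ^ 2 ≤ y ^ 2 * √l := le_mul_of_one_le_right (by positivity) hsl1
    have h11 : y * √l ≤ y ^ 2 * √l := by gcongr
    have h12 : √l ≤ y ^ 2 * √l := le_mul_of_one_le_left (by positivity) (hy1.trans h9)
    linarith
  have hmz := hmax (‖r‖⁻¹ • r)
  rw [hz, one_pow, mul_one] at hmz
  refine (signDist_leading_eigenvector_le (M := fun x => offProj u (B (offProj u x))) hw hz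
    (hds.trans_le hθs) hMw hmz hM).trans ?_
  calc 4 * (6400 / d ^ 2 * √l) / θ ≤ 4 * (6400 / d ^ 2 * √l) / (d * s) := by gcongr
    _ = _ := by field_simp; norm_num

end Compression

/-! ### Community indicators and the final estimate -/

section Communities

/-- The indicator vector of the community with label `k`. -/
noncomputable def communityVec {n : ℕ} {κ : Type*} [DecidableEq κ] (c : Fin n → κ) (k : κ) :
    EuclideanSpace ℝ (Fin n) :=
  WithLp.toLp 2 fun i => if c i = k then 1 else 0

variable {n : ℕ} {κ : Type*} [DecidableEq κ]

lemma inner_communityVec (c : Fin n → κ) (k : κ) (x : EuclideanSpace ℝ (Fin n)) :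
    ⟪communityVec c k, x⟫ = ∑ i, if c i = k then x i else 0 := by
  simp [communityVec, PiLp.inner_apply]

lemma inner_communityVec_of_ne (c : Fin n → κ) :
    Pairwise fun i j => ⟪communityVec c i, communityVec c j⟫ = 0 := by
  intro k k' hk
  rw [inner_communityVec]
  refine Finset.sum_eq_zero fun i _ => ?_
  by_cases h : c i = k
  · simp [communityVec, h, hk]
  · simp [h]

lemma norm_communityVec_sq (c : Fin n → κ) (k : κ) :
    ‖communityVec c k‖ ^ 2 = (Finset.univ.filter fun i => c i = k).card := by
  rw [← real_inner_self_eq_norm_sq, inner_communityVec, Finset.card_filter]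
  push_cast
  refine Finset.sum_congr rfl fun i _ => ?_
  by_cases h : c i = k <;> simp [communityVec, h]

lemma IsSBM.toEuclideanLin_expMatrix [Fintype κ] {Ω : Type*} [MeasurableSpace Ω] {μ : Measure Ω}
    {c : Fin n → κ} {p q : ℝ} {W : Ω → Matrix (Fin n) (Fin n) ℝ} (h : IsSBM μ c p q W) :
    Matrix.toEuclideanLin (expMatrix μ W) = blockMean (p - q) q (communityVec c) := by
  refine LinearMap.ext fun x => ?_
  have hS : ⟪∑ k, communityVec c k, x⟫ = ∑ j, x j := by
    simp only [sum_inner, inner_communityVec]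
    rw [Finset.sum_comm]
    simp
  rw [blockMean_apply, hS]
  ext i
  simp only [Matrix.toLpLin_apply, Matrix.mulVec, dotProduct, h.expMatrix_apply,
    WithLp.ofLp_sum, Finset.sum_apply, smul_eq_mul, communityVec, mul_ite,
    mul_one, mul_zero, WithLp.ofLp_smul, Pi.smul_apply]
  rw [Finset.sum_ite_eq Finset.univ (c i)]
  simp only [Finset.mem_univ, if_true]
  have := inner_communityVec c (c i) x
  rw [communityVec] at this
  rw [this, Finset.mul_sum, Finset.mul_sum, ← Finset.sum_add_distrib]
  refine Finset.sum_congr rfl fun j _ => ?_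
  by_cases hj : c j = c i
  · simp [hj]; ring
  · simp [hj, Ne.symm hj]

lemma toEuclideanLin_mul_apply (M N : Matrix (Fin n) (Fin n) ℝ) (x : EuclideanSpace ℝ (Fin n)) :
    Matrix.toEuclideanLin (M * N) x = Matrix.toEuclideanLin M (Matrix.toEuclideanLin N x) := by
  simp [Matrix.toLpLin_apply, Matrix.mulVec_mulVec]

lemma toEuclideanLin_projOff (u : Fin 2 → EuclideanSpace ℝ (Fin n)) :
    Matrix.toEuclideanLin (projOff u) = offProj u := by
  refine LinearMap.ext fun x => ?_
  rw [offProj_apply]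
  ext i
  simp [projOff, Matrix.toLpLin_apply, Matrix.vecMulVec_mulVec,
    PiLp.inner_apply, dotProduct, mul_comm]

lemma communityVec_mergeBetaGamma (c : Fin n → Fin 3) :
    communityVec (fun i => mergeBetaGamma (c i)) =
      ![communityVec c 0, communityVec c 1 + communityVec c 2] := by
  funext k
  ext i
  have : ∀ j : Fin 3, j = 0 ∨ j = 1 ∨ j = 2 := by decide
  fin_cases k <;> rcases this (c i) with h | h | h <;> simp [communityVec, mergeBetaGamma, h]

end Communities

theorem lemma2 (p q : ℝ) (hq : 0 ≤ q) (hqp : q < p) (hp : p ≤ 1) :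
    ∃ C₂ C₃ : ℝ, 0 < C₂ ∧ 0 < C₃ ∧
      ∀ (l s : ℕ), 1 ≤ s → s < l →
      ∀ (c : Fin (2 * l + s) → Fin 3),
        (Finset.univ.filter fun i => c i = 0).card = l →
        (Finset.univ.filter fun i => c i = 1).card = l →
        (Finset.univ.filter fun i => c i = 2).card = s →
      ∀ {Ω : Type*} [MeasurableSpace Ω] (μ : Measure Ω) [IsProbabilityMeasure μ]
        (WA WB : Ω → Matrix (Fin (2 * l + s)) (Fin (2 * l + s)) ℝ),
        IsSBM μ (fun i => mergeBetaGamma (c i)) p q WA →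
        IsSBM μ c p q WB →
      ∀ (v : Fin 3 → EuclideanSpace ℝ (Fin (2 * l + s))),
        IsLeadingEigenvectors (expMatrix μ WB) v →
        1 - Real.exp (-(l : ℝ)) ≤ μ.real {ω |
          ∀ (u : Fin 2 → EuclideanSpace ℝ (Fin (2 * l + s)))
            (w : Fin 1 → EuclideanSpace ℝ (Fin (2 * l + s))),
            IsLeadingEigenvectors (WA ω) u →
            IsLeadingEigenvectors (projOff u * WB ω * projOff u) w →
            min ‖w 0 - v 2‖ ‖w 0 + v 2‖ ≤
              C₂ * (Real.sqrt l / s) + C₃ * Real.sqrt ((s : ℝ) / l)} := by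
  have hd : 0 < p - q := sub_pos.2 hqp
  refine ⟨25600 / (p - q) ^ 3, 4, by positivity, by norm_num, ?_⟩
  intro l s hs hsl c hc0 hc1 hc2 Ω _ μ _ WA WB hWA hWB v hv
  have hs' : (0 : ℝ) < s := by exact_mod_cast hs
  have hsl' : (s : ℝ) < l := by exact_mod_cast hsl
  have hl' : (1 : ℝ) ≤ l := by exact_mod_cast hs.trans hsl.le
  set e := communityVec c with he
  have heo : Pairwise fun i j => ⟪e i, e j⟫ = 0 := inner_communityVec_of_ne c
  have h0 : ‖e 0‖ ^ 2 = l := by rw [he, norm_communityVec_sq, hc0]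
  have h1 : ‖e 1‖ ^ 2 = l := by rw [he, norm_communityVec_sq, hc1]
  have h2 : ‖e 2‖ ^ 2 = s := by rw [he, norm_communityVec_sq, hc2]
  have hEA := hWA.toEuclideanLin_expMatrix
  rw [communityVec_mergeBetaGamma, ← he] at hEA
  have hEB := hWB.toEuclideanLin_expMatrix
  rw [← he] at hEB
  obtain ⟨SA, hSAm, hSA, hA⟩ := hWA.exists_concentration_event (l := l) (by omega) (by omega)
  obtain ⟨SB, hSBm, hSB, hB⟩ := hWB.exists_concentration_event (l := l) (by omega) (by omega)
  rw [hEA] at hA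
  rw [hEB] at hB
  -- Only the union bound is used, so the joint law of the two matrices is irrelevant.
  have hprob : 1 - Real.exp (-(l : ℝ)) ≤ μ.real (SA ∩ SB) := by
    have h3 : μ.real (SA ∩ SB)ᶜ ≤ μ.real SAᶜ + μ.real SBᶜ := by
      rw [Set.compl_inter]; exact measureReal_union_le _ _
    have h4 := probReal_compl_eq_one_sub (μ := μ) (hSAm.inter hSBm)
    linarith
  refine hprob.trans (measureReal_mono ?_)
  rintro ω ⟨hωA, hωB⟩ u w ⟨b, ev, hev, hb, hle, hu⟩ ⟨b', ev', hev', hb', hle', hw⟩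
  obtain ⟨bv, evv, hevv, hbv, hlev, hvb⟩ := hv
  have hM : ∀ x, Matrix.toEuclideanLin (projOff u * WB ω * projOff u) x =
      offProj u (Matrix.toEuclideanLin (WB ω) (offProj u x)) := fun x => by
    rw [toEuclideanLin_mul_apply, toEuclideanLin_mul_apply, toEuclideanLin_projOff]
  have hw0 : w 0 = b' ⟨0, by omega⟩ := hw 0
  have hwz : signDist (w 0) _ ≤ 25600 / (p - q) ^ 3 * (√(l : ℝ) / s) :=
    signDist_compression_le (n := 2 * l + s) (by omega) hev hb (fun k _ => hu k) hl' hs' hsl'.le hd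
      (by linarith) hq (by linarith) heo h0 h1 h2 (hA ω hωA) (hB ω hωB)
      (by rw [hw0, b'.norm_eq_one]) (by rw [← hM, hw0]; exact hb' _) fun x => by
        rw [← hM, inner_apply_self_eq_sum_eigenvalues b' hb', ← b'.sum_sq_inner_right,
          Finset.mul_sum]
        refine Finset.sum_le_sum fun i _ => ?_
        exact mul_le_mul_of_nonneg_right (hev' (Fin.mk_le_of_le_val (Nat.zero_le _)))
          (sq_nonneg _)
  have hzg := signDist_normalized_splitVec_le (by linarith) hs' heo h1 h2
  rw [hEB] at hbv
  have hgv : signDist (v 2) ((√(s : ℝ))⁻¹ • e 2) ≤ 2 * √((s : ℝ) / l) := by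
    rw [hvb 2]
    exact signDist_third_eigenvector_le hevv hbv (by omega) hs' hsl' hd hq heo h0 h1 h2
  rw [signDist_comm] at hgv
  change signDist (w 0) (v 2) ≤ _
  have h5 := signDist_triangle (w 0) (‖splitVec (l : ℝ) s e‖⁻¹ • splitVec (l : ℝ) s e) (v 2)
  have h6 := signDist_triangle (‖splitVec (l : ℝ) s e‖⁻¹ • splitVec (l : ℝ) s e)
    ((√(s : ℝ))⁻¹ • e 2) (v 2)
  linarith
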